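/- Let $f:\mathbb T^3\to\mathbb T^3$ be a $C^1$ diffeomorphism of the torus $\mathbb T^3=\mathbb R^3/\mathbb Z^3$ with its flat metric. Suppose that $T\mathbb T^3$ has two continuous $Tf$-invariant two-dimensional subbundles $E$ and $G$ that are transverse to each other at every point, and let $F=E\cap G$, a one-dimensional invariant subbundle. Suppose that there are closed cones $\mathcal C^E\subset E$ and $\mathcal C^G\subset G$ (closed subsets of $T\mathbb T^3$ that are stable under multiplication by real numbers and contain a nonzero vector over every point), both transverse to $F$ (that is, $\mathcal C^E\cap F$ and $\mathcal C^G\cap F$ contain only zero vectors), such that $$Tf(\mathcal C^G)\subset \mathrm{Int}(\mathcal C^G),\qquad Tf^{-1}(\mathcal C^E)\subset \mathrm{Int}(\mathcal C^E),$$ where $\mathrm{Int}(\mathcal C^E)$ and $\mathrm{Int}(\mathcal C^G)$ denote the interiors relative to the total spaces of $E$ and $G$, together with the zero vectors. Then $$E'=\bigcap_{n\ge 0}Tf^{-n}(\mathcal C^E),\qquad G'=\bigcap_{n\ge 0}Tf^{n}(\mathcal C^G)$$ are continuous invariant line bundles and $T\mathbb T^3=E'\oplus F\oplus G'$ is a dominated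 splitting: there are $C>0$ and $\rho\in(0,1)$ such that for all $x\in\mathbb T^3$, all $n\ge 0$ and all unit vectors $u\in E'(x)$, $v\in F(x)$, $w\in G'(x)$, $$\|Tf^n u\|\le C\rho^n\|Tf^n v\|\quad\text{and}\quad \|Tf^n v\|\le C\rho^n\|Tf^n w\|.$$ Moreover, if for every $x\in\mathbb T^3$ $$|\det Tf|_{E(x)}|<\|Tf|_{F(x)}\|<|\det Tf|_{G(x)}|,$$ then $f$ is partially hyperbolic with splitting $E^s\oplus E^c\oplus E^u=E'\oplus F\oplus G'$: for some smooth Riemannian metric $|\cdot|$ on $\mathbb T^3$, all $x\in\mathbb T^3$ and all unit (for this metric) vectors $v^\sigma\in E^\sigma(x)$, $\sigma=s,c,u$, satisfy $|Tf v^s|<|Tf v^c|<|Tf v^u|$, $|Tf v^s|<1$ and $|Tf^{-1}v^u|<1$. -/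

import Mathlib

open scoped Topology ContDiff

noncomputable section

/-- Euclidean space `ℝ³`, which is also every tangent space of `𝕋³`. -/
abbrev E3 : Type := EuclideanSpace ℝ (Fin 3)

/-- The torus `𝕋³ = (ℝ/ℤ)³`. -/
abbrev T3 : Type := UnitAddTorus (Fin 3)

/-- The tangent bundle of `𝕋³`, with its standard trivialization `T𝕋³ = 𝕋³ × ℝ³`. -/
abbrev TT3 : Type := T3 × E3

/-- The covering projection `ℝ³ → 𝕋³`. -/
def torusProj (p : E3) : T3 := fun i => ((p i : ℝ) : UnitAddCircle)

/-- `f : 𝕋³ → 𝕋³` is differentiable at `x` with derivative `L`: read in the charts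
`v ↦ x + v mod ℤ³` at `x` and `w ↦ f x + w mod ℤ³` at `f x`, the map `f` is a map `g` with
`g 0 = 0` which is differentiable at `0` with derivative `L`. -/
def HasTorusFDerivAt (f : T3 → T3) (L : E3 →L[ℝ] E3) (x : T3) : Prop :=
  ∃ g : E3 → E3, g 0 = 0 ∧ HasFDerivAt g L 0 ∧
    ∀ᶠ v in 𝓝 (0 : E3), f (x + torusProj v) = f x + torusProj (g v)

/-- A `C¹` diffeomorphism of `𝕋³`: a homeomorphism which is differentiable at every point, with an
invertible derivative that depends continuously on the point.  The derivative is stored, but it is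
determined by the homeomorphism. -/
structure TorusDiffeo where
  toHomeomorph : T3 ≃ₜ T3
  deriv : T3 → (E3 ≃L[ℝ] E3)
  hasDeriv : ∀ x, HasTorusFDerivAt toHomeomorph (deriv x : E3 →L[ℝ] E3) x
  continuous_deriv : Continuous fun x => (deriv x : E3 →L[ℝ] E3)

namespace TorusDiffeo

instance : CoeFun TorusDiffeo (fun _ => T3 → T3) := ⟨fun f => f.toHomeomorph⟩

/-- The tangent map `Tf : T𝕋³ → T𝕋³`, `(x, v) ↦ (f x, T_x f v)`, a bijection with inverse
`T(f⁻¹)`. -/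
def tangentMap (f : TorusDiffeo) : TT3 ≃ TT3 where
  toFun p := (f.toHomeomorph p.1, f.deriv p.1 p.2)
  invFun p := (f.toHomeomorph.symm p.1, (f.deriv (f.toHomeomorph.symm p.1)).symm p.2)
  left_inv p := by simp
  right_inv p := by simp

end TorusDiffeo

/-- A continuous rank `k` subbundle of `T𝕋³`: near every point it has a continuous frame. -/
def IsSubbundle (k : ℕ) (E : T3 → Submodule ℝ E3) : Prop :=
  ∀ x : T3, ∃ U ∈ 𝓝 x, ∃ s : Fin k → T3 → E3, (∀ i, ContinuousOn (s i) U) ∧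
    ∀ y ∈ U, LinearIndependent ℝ (fun i => s i y) ∧
      Submodule.span ℝ (Set.range fun i => s i y) = E y

/-- The total space of a family of subspaces, as a subset of `T𝕋³`. -/
def totalSpace (E : T3 → Submodule ℝ E3) : Set TT3 := {p | p.2 ∈ E p.1}

/-- `Tf(E) = E`. -/
def IsInvariantBundle (f : TorusDiffeo) (E : T3 → Submodule ℝ E3) : Prop :=
  ∀ x, (E x).map ((f.deriv x : E3 →L[ℝ] E3) : E3 →ₗ[ℝ] E3) = E (f x)

/-- A closed cone (field) in the bundle `E`: a closed subset of `T𝕋³`, contained in `E`, stable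
under multiplication by real numbers, and with a nonzero vector in every fibre. -/
structure IsClosedCone (C : Set TT3) (E : T3 → Submodule ℝ E3) : Prop where
  isClosed : IsClosed C
  subset : C ⊆ totalSpace E
  smul_mem : ∀ (x : T3) (v : E3) (c : ℝ), (x, v) ∈ C → (x, c • v) ∈ C
  nontrivial : ∀ x : T3, ∃ v : E3, v ≠ 0 ∧ (x, v) ∈ C

/-- The cone `C` is transverse to the line bundle `F`: they share only zero vectors. -/
def ConeTransverse (C : Set TT3) (F : T3 → Submodule ℝ E3) : Prop :=
  ∀ (x : T3) (v : E3), (x, v) ∈ C → v ∈ F x → v = 0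

/-- The interior of the cone `C` in the bundle `E`: the interior of `C` relative to the total space
of `E`, together with the zero vectors, as is the convention for cones. -/
def coneInterior (C : Set TT3) (E : T3 → Submodule ℝ E3) : Set TT3 :=
  {p | p ∈ totalSpace E ∧ (C ∈ 𝓝[totalSpace E] p ∨ p.2 = 0)}

/-- `|det (L|_W)|`: the factor by which `L : W → L(W)` multiplies Euclidean volume, that is
`√(det (AᵀA))` for `A = L|_W`. -/
def absDetOn (L : E3 →L[ℝ] E3) (W : Submodule ℝ E3) : ℝ :=
  Real.sqrt (LinearMap.det
    (((ContinuousLinearMap.adjoint (L.comp W.subtypeL)).comp (L.comp W.subtypeL) : W →L[ℝ] W) :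
      W →ₗ[ℝ] W))

/-- `‖L|_W‖`, the Euclidean operator norm. -/
def normOn (L : E3 →L[ℝ] E3) (W : Submodule ℝ E3) : ℝ := ‖L.comp W.subtypeL‖

/-- `T𝕋³ = E₁ ⊕ E₂ ⊕ E₃`, a splitting into three continuous invariant line bundles. -/
structure IsInvariantSplitting (f : TorusDiffeo) (E₁ E₂ E₃ : T3 → Submodule ℝ E3) : Prop where
  bundle₁ : IsSubbundle 1 E₁
  bundle₂ : IsSubbundle 1 E₂
  bundle₃ : IsSubbundle 1 E₃
  invariant₁ : IsInvariantBundle f E₁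
  invariant₂ : IsInvariantBundle f E₂
  invariant₃ : IsInvariantBundle f E₃
  disjoint : ∀ x, Disjoint (E₂ x) (E₃ x)
  isCompl : ∀ x, IsCompl (E₁ x) (E₂ x ⊔ E₃ x)

/-- `F₂` dominates `F₁`: there are `C > 0` and `0 < ρ < 1` with
`‖Tfⁿ u‖ ≤ C ρⁿ ‖Tfⁿ v‖` for all `x`, all `n ≥ 0` and all unit vectors `u ∈ F₁(x)`,
`v ∈ F₂(x)`. -/
def IsDominatedBy (f : TorusDiffeo) (F₁ F₂ : T3 → Submodule ℝ E3) : Prop :=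
  ∃ C ρ : ℝ, 0 < C ∧ 0 < ρ ∧ ρ < 1 ∧
    ∀ (x : T3) (n : ℕ), ∀ u ∈ F₁ x, ∀ v ∈ F₂ x, ‖u‖ = 1 → ‖v‖ = 1 →
      ‖(f.tangentMap^[n] (x, u)).2‖ ≤ C * ρ ^ n * ‖(f.tangentMap^[n] (x, v)).2‖

/-- The dominated splittings of `T𝕋³` into three invariant line bundles. -/
structure IsDominatedSplitting (f : TorusDiffeo) (E₁ E₂ E₃ : T3 → Submodule ℝ E3) : Prop where
  splitting : IsInvariantSplitting f E₁ E₂ E₃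
  dominated₁₂ : IsDominatedBy f E₁ E₂
  dominated₂₃ : IsDominatedBy f E₂ E₃

/-- A smooth Riemannian metric on `𝕋³`. -/
structure TorusRiemannianMetric where
  inner : T3 → E3 →L[ℝ] E3 →L[ℝ] ℝ
  symm : ∀ x v w, inner x v w = inner x w v
  pos : ∀ x v, v ≠ 0 → 0 < inner x v v
  contDiff : ContDiff ℝ ∞ fun p : E3 => inner (torusProj p)

/-- The norm `|v|` of `v ∈ T_x 𝕋³`. -/
def TorusRiemannianMetric.norm (g : TorusRiemannianMetric) (x : T3) (v : E3) : ℝ :=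
  Real.sqrt (g.inner x v v)

/-- `f` is partially hyperbolic with splitting `T𝕋³ = Eˢ ⊕ Eᶜ ⊕ Eᵘ`: for a suitable Riemannian
metric, all unit vectors satisfy `|Tf vˢ| < |Tf vᶜ| < |Tf vᵘ|`, `|Tf vˢ| < 1` and
`|Tf⁻¹ vᵘ| < 1`. -/
structure IsPartiallyHyperbolic (f : TorusDiffeo) (Es Ec Eu : T3 → Submodule ℝ E3) : Prop where
  splitting : IsInvariantSplitting f Es Ec Eu
  metric : ∃ g : TorusRiemannianMetric,
    (∀ x, ∀ vs ∈ Es x, ∀ vc ∈ Ec x, ∀ vu ∈ Eu x,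
      g.norm x vs = 1 → g.norm x vc = 1 → g.norm x vu = 1 →
        g.norm (f x) (f.deriv x vs) < g.norm (f x) (f.deriv x vc) ∧
        g.norm (f x) (f.deriv x vc) < g.norm (f x) (f.deriv x vu)) ∧
    (∀ x, ∀ vs ∈ Es x, g.norm x vs = 1 → g.norm (f x) (f.deriv x vs) < 1) ∧
    (∀ x, ∀ vu ∈ Eu x, g.norm x vu = 1 →
      g.norm (f.tangentMap.symm (x, vu)).1 (f.tangentMap.symm (x, vu)).2 < 1)

end

/-! Domination comes from the width of a cone along `F`. Let `w` and `w + z` lie in the cone of `G`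
over one point, with `z ∈ F`. Transversality and compactness bound `‖z‖` by a multiple of `‖w‖`.
Since the image of the cone lies in its interior, the images of the two vectors can be pushed apart
along `F` by a uniform proportion without leaving the cone, so `(1 + δ) Tf z` is again a difference
of two cone vectors. Iterating gives `(1 + δ)ⁿ ‖Tfⁿ z‖ ≤ K ‖Tfⁿ w‖`
(`exists_pow_mul_norm_iterate_le`); convexity plays no role. Applied to preimages, this shows that
the nested intersection meets each fibre in one line; applied to images, that this line dominates
`F` (`exists_line_of_image_subset_coneInterior`). The intersection is closed, hence the line is
continuous. The same criterion for `Tf⁻¹` gives `E'`.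

For partial hyperbolicity, area in `E = E' ⊕ F` is the product of two lengths and the sine of an
angle. If the Jacobian on `E` is below the rate on `F`, the rate on `E'` is below a quotient of
sines that telescopes along orbits, so long products contract `E'`; likewise `G'` is expanded
(`eventually_contracting`, `eventually_expanding`). At some time `N` all required inequalities hold
at once. Rescaling lengths on each line by a geometric mean (`exists_cohomologous_geom_mean`) brings
them to time one for a continuous metric in which the lines are orthogonal. They are strict and the
torus is compact, so they survive smoothing of the metric (`isPartiallyHyperbolic_of_orbitProd`). -/

/-! ### Uniform estimates for closed cones. -/

theorem isCompact_sphereBundle {C : Set TT3} (hC : IsClosed C) :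
    IsCompact {p : TT3 | p ∈ C ∧ ‖p.2‖ = 1} := by
  have h : {p : TT3 | p ∈ C ∧ ‖p.2‖ = 1} =
      C ∩ (Set.univ : Set T3) ×ˢ Metric.sphere (0 : E3) 1 := by
    ext p; simp
  rw [h]
  exact (isCompact_univ.prod (isCompact_sphere 0 1)).inter_left hC

theorem IsClosedCone.zero_mem {C : Set TT3} {G : T3 → Submodule ℝ E3} (hC : IsClosedCone C G)
    (x : T3) : (x, (0 : E3)) ∈ C := by
  obtain ⟨v, -, hv⟩ := hC.nontrivial x
  simpa using hC.smul_mem x v 0 hv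

/-- A closed cone transverse to a line bundle makes an angle with it that is bounded below. -/
theorem exists_mul_norm_le_norm_add {C : Set TT3} {F G : T3 → Submodule ℝ E3}
    (hC : IsClosedCone C G) (hF : IsClosed (totalSpace F)) (hCF : ConeTransverse C F) :
    ∃ c : ℝ, 0 < c ∧ ∀ x w z, (x, w) ∈ C → z ∈ F x → c * ‖w‖ ≤ ‖w + z‖ := by
  -- For unit `w`, any `z` of norm above 2 already gives `‖w + z‖ > 1`; so a compact set of pairs
  -- suffices, with `c ≤ 1`.
  have hK : IsCompact {q : TT3 × E3 | (q.1 ∈ C ∧ ‖q.1.2‖ = 1) ∧ q.2 ∈ F q.1.1 ∧ ‖q.2‖ ≤ 2} := by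
    have h : {q : TT3 × E3 | (q.1 ∈ C ∧ ‖q.1.2‖ = 1) ∧ q.2 ∈ F q.1.1 ∧ ‖q.2‖ ≤ 2} =
        ((fun q : TT3 × E3 => ((q.1.1, q.2) : TT3)) ⁻¹' totalSpace F) ∩
          {p : TT3 | p ∈ C ∧ ‖p.2‖ = 1} ×ˢ Metric.closedBall (0 : E3) 2 := by
      ext q; simp [totalSpace]; tauto
    rw [h]
    exact ((isCompact_sphereBundle hC.isClosed).prod (isCompact_closedBall 0 2)).inter_left
      (hF.preimage (by fun_prop))
  have hpos : ∃ c : ℝ, 0 < c ∧ c ≤ 1 ∧ ∀ q ∈ {q : TT3 × E3 | (q.1 ∈ C ∧ ‖q.1.2‖ = 1) ∧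
      q.2 ∈ F q.1.1 ∧ ‖q.2‖ ≤ 2}, c ≤ ‖q.1.2 + q.2‖ := by
    rcases Set.eq_empty_or_nonempty {q : TT3 × E3 | (q.1 ∈ C ∧ ‖q.1.2‖ = 1) ∧
      q.2 ∈ F q.1.1 ∧ ‖q.2‖ ≤ 2} with h | h
    · exact ⟨1, one_pos, le_rfl, by rw [h]; simp⟩
    · obtain ⟨q, hq, hmin⟩ := hK.exists_isMinOn h
        (f := fun q : TT3 × E3 => ‖q.1.2 + q.2‖) (by fun_prop)
      refine ⟨min 1 ‖q.1.2 + q.2‖, lt_min one_pos (norm_pos_iff.2 fun h0 => ?_), min_le_left _ _,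
        fun p hp => (min_le_right _ _).trans (hmin hp)⟩
      have h1 : q.1.2 ∈ F q.1.1 := by
        rw [eq_neg_of_add_eq_zero_left h0]; exact (F q.1.1).neg_mem hq.2.1
      have := hCF q.1.1 q.1.2 hq.1.1 h1
      have h2 := hq.1.2
      rw [this] at h2
      simp at h2
  obtain ⟨c, hc, hc1, hmin⟩ := hpos
  refine ⟨c, hc, fun x w z hw hz => ?_⟩
  by_cases hw0 : w = 0
  · simp [hw0]
  have hwpos : 0 < ‖w‖ := norm_pos_iff.2 hw0
  have key : c ≤ ‖‖w‖⁻¹ • w + ‖w‖⁻¹ • z‖ := by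
    have hn : ‖‖w‖⁻¹ • w‖ = 1 := by rw [norm_smul, norm_inv, norm_norm, inv_mul_cancel₀ hwpos.ne']
    by_cases h2 : ‖‖w‖⁻¹ • z‖ ≤ 2
    · exact hmin ((x, ‖w‖⁻¹ • w), ‖w‖⁻¹ • z)
        ⟨⟨hC.smul_mem _ _ _ hw, hn⟩, (F x).smul_mem _ hz, h2⟩
    · have := norm_sub_le (‖w‖⁻¹ • w + ‖w‖⁻¹ • z) (‖w‖⁻¹ • w)
      rw [add_sub_cancel_left] at this
      linarith
  rw [← smul_add, norm_smul, norm_inv, norm_norm] at key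
  calc c * ‖w‖ ≤ (‖w‖⁻¹ * ‖w + z‖) * ‖w‖ := by gcongr
    _ = ‖w + z‖ := by field_simp

/-- If a bundle automorphism maps a closed cone into its interior, then the image has a
neighbourhood of uniform size in the cone. -/
theorem exists_add_mem_of_image_subset_coneInterior {C : Set TT3} {F G : T3 → Submodule ℝ E3}
    (T : TT3 ≃ₜ TT3) (hC : IsClosedCone C G) (hFG : ∀ x, F x ≤ G x)
    (hT : T '' C ⊆ coneInterior C G) (hsmul : ∀ x v (c : ℝ), (x, v) ∈ T '' C → (x, c • v) ∈ T '' C) :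
    ∃ ε : ℝ, 0 < ε ∧ ∀ x w z, (x, w) ∈ T '' C → z ∈ F x → ‖z‖ ≤ ε * ‖w‖ → (x, w + z) ∈ C := by
  have hK := isCompact_sphereBundle ((T.isClosed_image).2 hC.isClosed)
  -- A neighbourhood relative to `G` becomes an ordinary one for the set of points that are in `C`
  -- whenever they are in `G`.
  have hU : {p : TT3 | p ∈ T '' C ∧ ‖p.2‖ = 1} ⊆ interior {q | q ∈ totalSpace G → q ∈ C} := by
    rintro p ⟨hp, hn⟩
    obtain ⟨-, h | h⟩ := hT hp
    · rw [mem_interior_iff_mem_nhds]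
      exact mem_nhdsWithin_iff_eventually.1 h
    · simp [h] at hn
  obtain ⟨ε, hε, hsub⟩ := hK.exists_thickening_subset_open isOpen_interior hU
  -- Halved because the thickening is open while the bound on `‖z‖` is not strict.
  refine ⟨ε / 2, half_pos hε, fun x w z hw hz hzw => ?_⟩
  by_cases hw0 : w = 0
  · have : z = 0 := by simpa [hw0] using hzw
    subst this hw0
    simpa using hC.zero_mem x
  have hwpos : 0 < ‖w‖ := norm_pos_iff.2 hw0
  have hn : ‖‖w‖⁻¹ • w‖ = 1 := by rw [norm_smul, norm_inv, norm_norm, inv_mul_cancel₀ hwpos.ne']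
  have hwG : (x, w) ∈ totalSpace G := (hT hw).1
  have hmem : (x, ‖w‖⁻¹ • w + ‖w‖⁻¹ • z) ∈ C := by
    refine interior_subset (hsub ?_) ?_
    · refine Metric.mem_thickening_iff.2 ⟨(x, ‖w‖⁻¹ • w), ⟨hsmul _ _ _ hw, hn⟩, ?_⟩
      rw [Prod.dist_eq]
      simp only [dist_self, dist_eq_norm, add_sub_cancel_left]
      rw [norm_smul, norm_inv, norm_norm]
      refine max_lt hε ?_
      calc ‖w‖⁻¹ * ‖z‖ ≤ ‖w‖⁻¹ * (ε / 2 * ‖w‖) := by gcongr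
        _ = ε / 2 := by field_simp
        _ < ε := half_lt_self hε
    · exact (G x).add_mem ((G x).smul_mem _ hwG) ((G x).smul_mem _ (hFG x hz))
  have := hC.smul_mem _ _ ‖w‖ hmem
  rwa [← smul_add, smul_smul, mul_inv_cancel₀ hwpos.ne', one_smul] at this

/-! ### Growth of the width of a cone under iteration. -/

section Iterate

variable {T : TT3 ≃ₜ TT3} {b : T3 → T3} {A : T3 → E3 →ₗ[ℝ] E3}
  (hTA : ∀ x v, T (x, v) = (b x, A x v))
include hTA

theorem exists_iterate_eq (n : ℕ) :
    ∃ B : T3 → E3 →ₗ[ℝ] E3, ∀ x v, T^[n] (x, v) = (b^[n] x, B x v) := by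
  induction n with
  | zero => exact ⟨fun _ => LinearMap.id, fun x v => rfl⟩
  | succ n ih =>
    obtain ⟨B, hB⟩ := ih
    exact ⟨fun x => (A (b^[n] x)).comp (B x), fun x v => by
      rw [Function.iterate_succ_apply', hB, hTA, Function.iterate_succ_apply']; rfl⟩

theorem mem_iterate_iff {F : T3 → Submodule ℝ E3} (hF : ∀ x v, A x v ∈ F (b x) ↔ v ∈ F x) (n : ℕ)
    (p : TT3) : T^[n] p ∈ totalSpace F ↔ p ∈ totalSpace F := by
  induction n with
  | zero => rfl
  | succ n ih =>
    rw [Function.iterate_succ_apply', ← ih]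
    generalize T^[n] p = q
    obtain ⟨x, v⟩ := q
    rw [hTA]
    exact hF x v

theorem smul_mem_image_iterate {C : Set TT3} {G : T3 → Submodule ℝ E3} (hC : IsClosedCone C G)
    (n : ℕ) (x : T3) (v : E3) (c : ℝ) (h : (x, v) ∈ T^[n] '' C) : (x, c • v) ∈ T^[n] '' C := by
  obtain ⟨B, hB⟩ := exists_iterate_eq hTA n
  obtain ⟨⟨y, w⟩, hw, h⟩ := h
  rw [hB] at h
  obtain ⟨rfl, rfl⟩ := Prod.mk.inj h
  exact ⟨(y, c • w), hC.smul_mem _ _ _ hw, by rw [hB, map_smul]⟩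

/-- The diameter of a cone, measured along `F`, is expanded by less than the diameter of its
image: two vectors of the cone that differ by `z ∈ F` give, at time `n`, two vectors of the cone that
differ by `(1 + δ)ⁿ Tⁿz`. -/
theorem exists_pow_mul_norm_iterate_le {C : Set TT3} {F G : T3 → Submodule ℝ E3}
    (hC : IsClosedCone C G) (hF : IsClosed (totalSpace F)) (hCF : ConeTransverse C F)
    (hFG : ∀ x, F x ≤ G x) (hFinv : ∀ x v, A x v ∈ F (b x) ↔ v ∈ F x)
    (hT : T '' C ⊆ coneInterior C G) :
    ∃ δ K : ℝ, 0 < δ ∧ 0 < K ∧ ∀ x w z, (x, w) ∈ C → z ∈ F x → (x, w + z) ∈ C → ∀ n : ℕ,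
      (1 + δ) ^ n * ‖(T^[n] (x, z)).2‖ ≤ K * ‖(T^[n] (x, w)).2‖ := by
  obtain ⟨c, hc, hangle⟩ := exists_mul_norm_le_norm_add hC hF hCF
  obtain ⟨ε, hε, hthick⟩ := exists_add_mem_of_image_subset_coneInterior T hC hFG hT
    (smul_mem_image_iterate hTA hC 1)
  -- The width bound: the angle estimate at `w + z`, with `-z` added, gives `c * ‖w + z‖ ≤ ‖w‖`.
  have hbound : ∀ x w z, (x, w) ∈ C → z ∈ F x → (x, w + z) ∈ C → ‖z‖ ≤ (1 + c⁻¹) * ‖w‖ := by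
    intro x w z hw hz hwz
    have h1 := hangle x (w + z) (-z) hwz ((F x).neg_mem hz)
    rw [add_neg_cancel_right] at h1
    have h2 : ‖w + z‖ ≤ c⁻¹ * ‖w‖ := by rw [inv_mul_eq_div, le_div_iff₀' hc]; exact h1
    have h3 := norm_sub_le (w + z) w
    rw [add_sub_cancel_left] at h3
    linarith
  have hM : 0 < 1 + c⁻¹ := by positivity
  set M := 1 + c⁻¹ with hMdef
  -- With this value, a shift by `δ / 2` times a difference of norm at most `M * ‖y‖` has norm at
  -- most `ε * ‖y‖`, the room available in the cone.
  set δ := 2 * ε / M with hδdef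
  have hδ : 0 < δ := by positivity
  have hTC : ∀ p ∈ C, T p ∈ C := by
    rintro ⟨x, w⟩ hw
    have := hthick (T (x, w)).1 (T (x, w)).2 0 ⟨_, hw, rfl⟩ (F _).zero_mem (by simp; positivity)
    simpa using this
  -- The two image vectors are moved by `δ / 2` in opposite directions, which multiplies their
  -- difference by `1 + δ`.
  have hstep : ∀ x w z, (x, w) ∈ C → z ∈ F x → (x, w + z) ∈ C →
      (b x, A x w + (-(δ / 2)) • A x z) ∈ C ∧
      (b x, (A x w + (-(δ / 2)) • A x z) + (1 + δ) • A x z) ∈ C := by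
    intro x w z hw hz hwz
    have hz' := (hFinv x z).2 hz
    have hw' := hTC _ hw
    have hwz' := hTC _ hwz
    rw [hTA] at hw' hwz'
    have e1 : A x (w + z) + -A x z = A x w := by rw [map_add]; abel
    have b1 := hbound _ _ _ hw' hz' (by rw [← map_add]; exact hwz')
    have b2 := hbound _ _ (-A x z) hwz' ((F _).neg_mem hz') (by rw [e1]; exact hw')
    rw [norm_neg] at b2
    have hsz : ∀ y : E3, ‖A x z‖ ≤ M * ‖y‖ → δ / 2 * ‖A x z‖ ≤ ε * ‖y‖ := by
      intro y hy
      calc δ / 2 * ‖A x z‖ ≤ δ / 2 * (M * ‖y‖) := by gcongr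
        _ = ε * ‖y‖ := by rw [hδdef]; field_simp
    constructor
    · refine hthick _ _ _ ⟨_, hw, hTA x w⟩ ((F _).smul_mem _ hz') ?_
      rw [norm_smul, Real.norm_eq_abs, abs_neg, abs_of_pos (half_pos hδ)]
      exact hsz _ b1
    · have e2 : (A x w + (-(δ / 2)) • A x z) + (1 + δ) • A x z =
          A x (w + z) + (δ / 2) • A x z := by rw [map_add]; module
      rw [e2]
      refine hthick _ _ _ ⟨_, hwz, hTA x (w + z)⟩ ((F _).smul_mem _ hz') ?_
      rw [norm_smul, Real.norm_eq_abs, abs_of_pos (half_pos hδ)]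
      exact hsz _ b2
  refine ⟨δ, M / c, hδ, by positivity, fun x w z hw hz hwz n => ?_⟩
  -- The shifts accumulate, so the base vector `w'` is only congruent to the iterate of `w` modulo
  -- `F`; the angle estimate then bounds `‖w'‖` by that iterate.
  have hiter : ∃ w', w' - (T^[n] (x, w)).2 ∈ F (b^[n] x) ∧ (T^[n] (x, z)).2 ∈ F (b^[n] x) ∧
      (b^[n] x, w') ∈ C ∧ (b^[n] x, w' + (1 + δ) ^ n • (T^[n] (x, z)).2) ∈ C := by
    induction n with
    | zero => exact ⟨w, by simp, hz, hw, by simpa using hwz⟩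
    | succ n ih =>
      obtain ⟨w', h1, h2, h3, h4⟩ := ih
      obtain ⟨B, hB⟩ := exists_iterate_eq hTA n
      simp only [Function.iterate_succ_apply', hB, hTA] at h1 h2 h3 h4 ⊢
      obtain ⟨h5, h6⟩ := hstep _ _ _ h3 ((F _).smul_mem _ h2) h4
      refine ⟨_, ?_, (hFinv _ _).2 h2, h5, ?_⟩
      · have := (F _).add_mem ((hFinv _ _).2 h1) ((F _).smul_mem (-(δ / 2))
          ((hFinv _ _).2 ((F _).smul_mem ((1 + δ) ^ n) h2)))
        rw [map_sub] at this
        convert this using 1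
        abel
      · convert h6 using 2
        rw [map_smul, smul_smul (1 + δ), pow_succ' (1 + δ)]
  obtain ⟨w', h1, h2, h3, h4⟩ := hiter
  have b1 := hbound _ _ _ h3 ((F _).smul_mem _ h2) h4
  have b2 := hangle _ _ _ h3 ((F _).neg_mem h1)
  rw [norm_smul, Real.norm_eq_abs, abs_of_pos (by positivity)] at b1
  rw [neg_sub, add_sub_cancel] at b2
  calc (1 + δ) ^ n * ‖(T^[n] (x, z)).2‖ ≤ M * ‖w'‖ := b1
    _ = M / c * (c * ‖w'‖) := by field_simp
    _ ≤ M / c * ‖(T^[n] (x, w)).2‖ := by gcongr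

end Iterate

/-! ### The invariant line inside a cone. -/

section Iterate

variable {T : TT3 ≃ₜ TT3} {b : T3 → T3} {A : T3 → E3 →ₗ[ℝ] E3}
  (hTA : ∀ x v, T (x, v) = (b x, A x v))
include hTA

theorem iterate_fst (n : ℕ) (p : TT3) : (T^[n] p).1 = b^[n] p.1 := by
  obtain ⟨B, hB⟩ := exists_iterate_eq hTA n
  rw [hB p.1 p.2]

/-- Over every point, the images of a cone that is mapped into its interior share a nonzero
vector. -/
theorem exists_ne_zero_mem_iInter {C : Set TT3} {G : T3 → Submodule ℝ E3}
    (hC : IsClosedCone C G) (hTC : ∀ p ∈ C, T p ∈ C) (x : T3) :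
    ∃ v : E3, ‖v‖ = 1 ∧ (x, v) ∈ ⋂ n : ℕ, T^[n] '' C := by
  have hclosed : ∀ n, IsClosed (T^[n] '' C) := by
    intro n
    induction n with
    | zero => simpa using hC.isClosed
    | succ n ih =>
      rw [Function.iterate_succ', Set.image_comp]
      exact (T.isClosed_image).2 ih
  have hanti : ∀ n, T^[n + 1] '' C ⊆ T^[n] '' C := by
    rintro n _ ⟨p, hp, rfl⟩
    exact ⟨T p, hTC p hp, by rw [Function.iterate_succ_apply]⟩
  have hfib : ∀ n, IsCompact (T^[n] '' C ∩ ({x} ×ˢ Metric.sphere (0 : E3) 1)) := fun n =>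
    (isCompact_singleton.prod (isCompact_sphere 0 1)).inter_left (hclosed n)
  have hne : ∀ n, (T^[n] '' C ∩ ({x} ×ˢ Metric.sphere (0 : E3) 1)).Nonempty := by
    intro n
    obtain ⟨B, hB⟩ := exists_iterate_eq hTA n
    have hsurj : Function.Surjective T^[n] := T.surjective.iterate n
    -- Only the base point `y` over `x` is wanted here; surjectivity is known for `T`, not directly
    -- for `b`.
    obtain ⟨⟨y, v₀⟩, hy⟩ := hsurj (x, 0)
    rw [hB] at hy
    have hyx : b^[n] y = x := (Prod.mk.inj hy).1
    obtain ⟨w, hw0, hw⟩ := hC.nontrivial y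
    have hBw : B y w ≠ 0 := by
      intro h
      refine hw0 ?_
      have : T^[n] (y, w) = T^[n] (y, 0) := by rw [hB, hB, h, map_zero]
      exact (Prod.mk.inj (T.injective.iterate n this)).2
    refine ⟨(x, ‖B y w‖⁻¹ • B y w), ?_, rfl, ?_⟩
    · exact smul_mem_image_iterate hTA hC n _ _ _ ⟨(y, w), hw, by rw [hB, hyx]⟩
    · rw [mem_sphere_zero_iff_norm, norm_smul, norm_inv, norm_norm,
        inv_mul_cancel₀ (norm_ne_zero_iff.2 hBw)]
  have hinter := IsCompact.nonempty_iInter_of_sequence_nonempty_isCompact_isClosed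
    (fun n => T^[n] '' C ∩ ({x} ×ˢ Metric.sphere (0 : E3) 1))
    (fun n => Set.inter_subset_inter_left _ (hanti n)) hne (hfib 0)
    (fun n => (hfib n).isClosed)
  obtain ⟨⟨y, v⟩, hp⟩ := hinter
  rw [Set.mem_iInter] at hp
  obtain rfl : y = x := (hp 0).2.1
  exact ⟨v, by simpa using (hp 0).2.2, Set.mem_iInter.2 fun n => (hp n).1⟩

/-- The cone criterion: a closed cone in a plane bundle, transverse to an invariant line bundle and
mapped into its interior, contains a unique invariant line bundle, which dominates the former. -/
theorem exists_line_of_image_subset_coneInterior {C : Set TT3} {F G : T3 → Submodule ℝ E3}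
    (hC : IsClosedCone C G) (hF : IsClosed (totalSpace F)) (hCF : ConeTransverse C F)
    (hFG : ∀ x, F x ≤ G x) (hFinv : ∀ x v, A x v ∈ F (b x) ↔ v ∈ F x)
    (hcodim : ∀ x, ∀ w₁ ∈ G x, w₁ ∉ F x → ∀ w₂ ∈ G x, ∃ c : ℝ, w₂ - c • w₁ ∈ F x)
    (hT : T '' C ⊆ coneInterior C G) :
    ∃ L : T3 → Submodule ℝ E3, totalSpace L = ⋂ n : ℕ, T^[n] '' C ∧
      IsClosed (totalSpace L) ∧ (∀ x, L x ≤ G x) ∧ (∀ x, Disjoint (F x) (L x)) ∧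
      (∀ x, Module.finrank ℝ (L x) = 1) ∧ (∀ p, T p ∈ totalSpace L ↔ p ∈ totalSpace L) ∧
      ∃ K ρ : ℝ, 0 < K ∧ 0 < ρ ∧ ρ < 1 ∧ ∀ (x : T3) (n : ℕ), ∀ v ∈ F x, ∀ w ∈ L x,
        ‖v‖ = 1 → ‖w‖ = 1 → ‖(T^[n] (x, v)).2‖ ≤ K * ρ ^ n * ‖(T^[n] (x, w)).2‖ := by
  obtain ⟨δ, K, hδ, hK, hexp⟩ := exists_pow_mul_norm_iterate_le hTA hC hF hCF hFG hFinv hT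
  obtain ⟨ε, hε, hthick⟩ := exists_add_mem_of_image_subset_coneInterior T hC hFG hT
    (smul_mem_image_iterate hTA hC 1)
  have hTC : ∀ p ∈ C, T p ∈ C := by
    rintro ⟨x, w⟩ hw
    have := hthick (T (x, w)).1 (T (x, w)).2 0 ⟨_, hw, rfl⟩ (F _).zero_mem (by simp; positivity)
    simpa using this
  set I : Set TT3 := ⋂ n : ℕ, T^[n] '' C with hI
  have hIC : I ⊆ C := fun p hp => by simpa using Set.mem_iInter.1 hp 0
  have hIsmul : ∀ x v (c : ℝ), (x, v) ∈ I → (x, c • v) ∈ I := fun x v c h =>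
    Set.mem_iInter.2 fun n => smul_mem_image_iterate hTA hC n x v c (Set.mem_iInter.1 h n)
  have hIclosed : IsClosed I := by
    refine isClosed_iInter fun n => ?_
    induction n with
    | zero => simpa using hC.isClosed
    | succ n ih =>
      rw [Function.iterate_succ', Set.image_comp]
      exact (T.isClosed_image).2 ih
  -- Both vectors have preimages in `C` at every time `-n`. Applying the width estimate to these
  -- bounds `(1 + δ) ^ n * ‖z‖` independently of `n`. Zero vectors serve to identify the base points
  -- of the preimages.
  have hunique : ∀ x w z, (x, w) ∈ I → (x, w + z) ∈ I → z ∈ F x → z = 0 := by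
    intro x w z hw hwz hz
    by_contra hz0
    have hle : ∀ n : ℕ, (1 + δ) ^ n * ‖z‖ ≤ K * ‖w‖ := by
      intro n
      obtain ⟨B, hB⟩ := exists_iterate_eq hTA n
      obtain ⟨⟨y, w'⟩, hw', h1⟩ := Set.mem_iInter.1 hw n
      obtain ⟨⟨y', w''⟩, hw'', h2⟩ := Set.mem_iInter.1 hwz n
      obtain ⟨⟨y₁, z'⟩, h3⟩ := T.surjective.iterate n (x, z)
      have hyy : y' = y := by
        have : T^[n] (y', 0) = T^[n] (y, 0) := by
          rw [hB] at h1 h2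
          rw [hB, hB, (Prod.mk.inj h1).1, (Prod.mk.inj h2).1, map_zero, map_zero]
        exact (Prod.mk.inj (T.injective.iterate n this)).1
      have hyy₁ : y₁ = y := by
        have : T^[n] (y₁, 0) = T^[n] (y, 0) := by
          rw [hB] at h1 h3
          rw [hB, hB, (Prod.mk.inj h1).1, (Prod.mk.inj h3).1, map_zero, map_zero]
        exact (Prod.mk.inj (T.injective.iterate n this)).1
      subst hyy hyy₁
      have hz'F : z' ∈ F y₁ := (mem_iterate_iff hTA hFinv n (y₁, z')).1 (by rw [h3]; exact hz)
      have hsum : w'' = w' + z' := by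
        have : T^[n] (y₁, w'') = T^[n] (y₁, w' + z') := by
          rw [h2, hB, map_add]
          rw [hB] at h1 h3
          rw [(Prod.mk.inj h1).1, (Prod.mk.inj h1).2, (Prod.mk.inj h3).2]
        exact (Prod.mk.inj (T.injective.iterate n this)).2
      have := hexp y₁ w' z' hw' hz'F (hsum ▸ hw'') n
      rwa [h3, h1] at this
    have hzpos : 0 < ‖z‖ := norm_pos_iff.2 hz0
    obtain ⟨n, hn⟩ := pow_unbounded_of_one_lt (K * ‖w‖ / ‖z‖) (by linarith : 1 < 1 + δ)
    rw [div_lt_iff₀ hzpos] at hn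
    exact absurd (hle n) (not_le.2 hn)
  have hline : ∀ x w₁ w₂, (x, w₁) ∈ I → w₁ ≠ 0 → (x, w₂) ∈ I → ∃ c : ℝ, w₂ = c • w₁ := by
    intro x w₁ w₂ h1 h0 h2
    obtain ⟨c, hc⟩ := hcodim x w₁ (hC.subset (hIC h1)) (fun h => h0 (hCF _ _ (hIC h1) h)) w₂
      (hC.subset (hIC h2))
    have := hunique x (c • w₁) (w₂ - c • w₁) (hIsmul _ _ _ h1) (by simpa using h2) hc
    exact ⟨c, sub_eq_zero.1 this⟩
  choose e he1 heI using exists_ne_zero_mem_iInter hTA hC hTC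
  have he0 : ∀ x, e x ≠ 0 := fun x h => by simpa [h] using he1 x
  have htot : totalSpace (fun x => Submodule.span ℝ {e x}) = I := by
    ext ⟨x, v⟩
    constructor
    · intro h
      obtain ⟨c, hc⟩ := Submodule.mem_span_singleton.1 h
      simp only at hc
      rw [← hc]
      exact hIsmul _ _ _ (heI x)
    · intro h
      obtain ⟨c, hc⟩ := hline x _ v (heI x) (he0 x) h
      exact Submodule.mem_span_singleton.2 ⟨c, hc.symm⟩
  have hmemI : ∀ x w, w ∈ Submodule.span ℝ {e x} → (x, w) ∈ I := fun x w hw => by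
    rw [← htot]; exact hw
  refine ⟨fun x => Submodule.span ℝ {e x}, htot, htot ▸ hIclosed,
    fun x w hw => hC.subset (hIC (hmemI x w hw)), fun x => ?_,
    fun x => finrank_span_singleton (he0 x), ?_, K / ε, (1 + δ)⁻¹, by positivity, by positivity,
    inv_lt_one_of_one_lt₀ (by linarith), ?_⟩
  · rw [Submodule.disjoint_def]
    exact fun v hv hv' => hCF x v (hIC (hmemI x v hv')) hv
  · intro p
    rw [htot]
    constructor
    · intro h
      refine Set.mem_iInter.2 fun n => ?_
      obtain ⟨q, hq, h⟩ := Set.mem_iInter.1 h (n + 1)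
      rw [Function.iterate_succ_apply'] at h
      exact ⟨q, hq, T.injective h⟩
    · intro h
      refine Set.mem_iInter.2 fun n => ?_
      obtain ⟨q, hq, h⟩ := Set.mem_iInter.1 h n
      refine ⟨T q, hTC q hq, ?_⟩
      rw [← Function.iterate_succ_apply, Function.iterate_succ_apply', h]
  · intro x n v hv w hw hv1 hw1
    have hwI := hmemI x w hw
    have hwT : (x, w) ∈ T '' C := Set.mem_iInter.1 hwI 1
    -- As `w` lies in the image of the cone, `w + ε • v` is still in `C`, so every direction of `F`
    -- is a legitimate difference; dividing by `ε` gives the constant `K / ε`.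
    have hv' : ε • v ∈ F x := (F x).smul_mem _ hv
    have := hexp x w (ε • v) (hIC hwI) hv' (hthick x w _ hwT hv' (by
      rw [norm_smul, hv1, hw1, Real.norm_eq_abs, abs_of_pos hε])) n
    obtain ⟨B, hB⟩ := exists_iterate_eq hTA n
    rw [hB] at this ⊢
    rw [hB] at this ⊢
    simp only [map_smul, norm_smul, Real.norm_eq_abs, abs_of_pos hε] at this ⊢
    rw [inv_pow, ← div_eq_mul_inv, div_div, div_mul_eq_mul_div, le_div_iff₀ (by positivity)]
    linarith

end Iterate

/-! ### Continuity of subbundles and of their total spaces. -/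

/-- Continuity can be tested after pulling back to a compact space. -/
theorem continuous_of_comp_isCompact {Z Y : Type*} [TopologicalSpace Z] [TopologicalSpace Y]
    {K : Set Z} (hK : IsCompact K) {π : Z → T3} (hπ : Continuous π) (hsurj : ∀ x, ∃ k ∈ K, π k = x)
    {ψ : T3 → Y} {φ : Z → Y} (hφ : ContinuousOn φ K) (h : ∀ k ∈ K, ψ (π k) = φ k) :
    Continuous ψ := by
  have : CompactSpace K := isCompact_iff_compactSpace.1 hK
  have hq : Topology.IsQuotientMap (fun k : K => π k) :=
    Topology.IsQuotientMap.of_surjective_continuous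
      (fun x => let ⟨k, hk, e⟩ := hsurj x; ⟨⟨k, hk⟩, e⟩) (by fun_prop)
  rw [hq.continuous_iff]
  have : (ψ ∘ fun k : K => π k) = K.domRestrict φ := funext fun k => h k k.2
  rw [this]
  exact hφ.domRestrict

theorem exists_norm_eq_one_of_finrank_eq_one {W : Submodule ℝ E3} (h : Module.finrank ℝ W = 1) :
    ∃ u ∈ W, ‖u‖ = 1 := by
  have : Nontrivial W := Module.nontrivial_of_finrank_pos (R := ℝ) (by omega)
  obtain ⟨v, hv⟩ := exists_ne (0 : W)
  have hv' : (v : E3) ≠ 0 := fun h => hv (Subtype.ext h)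
  refine ⟨‖(v : E3)‖⁻¹ • (v : E3), W.smul_mem _ v.2, ?_⟩
  rw [norm_smul, norm_inv, norm_norm, inv_mul_cancel₀ (norm_ne_zero_iff.2 hv')]

theorem exists_eq_smul_of_finrank_eq_one {W : Submodule ℝ E3} (h : Module.finrank ℝ W = 1)
    {u v : E3} (hu : u ∈ W) (hu0 : u ≠ 0) (hv : v ∈ W) : ∃ c : ℝ, v = c • u := by
  obtain ⟨c, hc⟩ := (finrank_eq_one_iff_of_nonzero' (⟨u, hu⟩ : W)
    (fun h => hu0 (congrArg Subtype.val h))).1 h ⟨v, hv⟩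
  exact ⟨c, (congrArg Subtype.val hc).symm⟩

theorem eq_or_eq_neg_of_finrank_eq_one {W : Submodule ℝ E3} (h : Module.finrank ℝ W = 1)
    {u v : E3} (hu : u ∈ W) (hu1 : ‖u‖ = 1) (hv : v ∈ W) (hv1 : ‖v‖ = 1) : v = u ∨ v = -u := by
  obtain ⟨c, rfl⟩ := exists_eq_smul_of_finrank_eq_one h hu (fun h => by simp [h] at hu1) hv
  rw [norm_smul, hu1, mul_one, Real.norm_eq_abs] at hv1
  rcases eq_or_eq_neg_of_abs_eq hv1 with rfl | rfl <;> simp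

/-- A family of lines with closed total space is a continuous line bundle. -/
theorem isSubbundle_one_of_isClosed {L : T3 → Submodule ℝ E3} (hL : IsClosed (totalSpace L))
    (h1 : ∀ x, Module.finrank ℝ (L x) = 1) : IsSubbundle 1 L := by
  choose u huL hu1 using fun x => exists_norm_eq_one_of_finrank_eq_one (h1 x)
  intro x
  -- The chosen unit vector `u y` may jump in sign; this vector is even in `u y`, hence continuous,
  -- and is nonzero near `x`.
  have hcont : Continuous fun y => inner ℝ (u y) (u x) • u y := by
    refine continuous_of_comp_isCompact (isCompact_sphereBundle hL) continuous_fst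
      (fun y => ⟨(y, u y), ⟨huL y, hu1 y⟩, rfl⟩)
      (φ := fun p : TT3 => inner ℝ p.2 (u x) • p.2) (by fun_prop) ?_
    rintro ⟨y, v⟩ ⟨hv, hv1⟩
    rcases eq_or_eq_neg_of_finrank_eq_one (h1 y) (huL y) (hu1 y) hv hv1 with h | h <;>
      simp only at h <;> subst h <;> simp
  have hx : inner ℝ (u x) (u x) • u x ≠ 0 := by
    rw [real_inner_self_eq_norm_sq, hu1]
    intro h
    have := hu1 x
    simp only [one_pow, one_smul] at h
    simp [h] at this
  refine ⟨{y | inner ℝ (u y) (u x) • u y ≠ 0}, (isOpen_ne.preimage hcont).mem_nhds hx,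
    fun _ y => inner ℝ (u y) (u x) • u y, fun _ => hcont.continuousOn, fun y hy => ?_⟩
  refine ⟨linearIndependent_unique_iff.2 hy, ?_⟩
  rw [Set.range_const]
  refine le_antisymm ?_ fun v hv => ?_
  · rw [Submodule.span_le, Set.singleton_subset_iff]
    exact (L y).smul_mem _ (huL y)
  · obtain ⟨c, rfl⟩ := exists_eq_smul_of_finrank_eq_one (h1 y) ((L y).smul_mem _ (huL y)) hy hv
    exact Submodule.smul_mem _ _ (Submodule.mem_span_singleton_self _)

theorem IsSubbundle.finrank_eq {k : ℕ} {E : T3 → Submodule ℝ E3} (hE : IsSubbundle k E) (x : T3) :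
    Module.finrank ℝ (E x) = k := by
  obtain ⟨U, hU, s, -, hs⟩ := hE x
  obtain ⟨hli, hspan⟩ := hs x (mem_of_mem_nhds hU)
  rw [← hspan, finrank_span_eq_card hli, Fintype.card_fin]

/-- Lying outside the fibre means being independent of the local frame, and independence is an open
condition. -/
theorem IsSubbundle.isClosed_totalSpace {k : ℕ} {E : T3 → Submodule ℝ E3} (hE : IsSubbundle k E) :
    IsClosed (totalSpace E) := by
  rw [← isOpen_compl_iff, isOpen_iff_mem_nhds]
  rintro ⟨x, v⟩ hv
  obtain ⟨U, hU, s, hcont, hs⟩ := hE x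
  have hmem : ∀ y ∈ U, ∀ w, w ∉ E y ↔
      LinearIndependent ℝ (Fin.snoc (fun i => s i y) w : Fin (k + 1) → E3) := by
    intro y hy w
    rw [linearIndependent_finSnoc, (hs y hy).2]
    exact ⟨fun h => ⟨(hs y hy).1, h⟩, fun h => h.2⟩
  have hca : ContinuousAt (fun p : TT3 =>
      (Fin.snoc (fun i => s i p.1) p.2 : Fin (k + 1) → E3)) (x, v) := by
    rw [continuousAt_pi]
    refine Fin.lastCases ?_ fun i => ?_
    · simpa using continuousAt_snd
    · simp only [Fin.snoc_castSucc]
      exact ((hcont i).continuousAt hU).comp (f := (Prod.fst : TT3 → T3)) (x := (x, v))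
        continuousAt_fst
  have hopen := hca.preimage_mem_nhds ((isOpen_setOfPred_linearIndependent (𝕜 := ℝ)).mem_nhds
    ((hmem x (mem_of_mem_nhds hU) v).1 hv))
  have hU' : Prod.fst ⁻¹' U ∈ 𝓝 ((x, v) : TT3) := continuousAt_fst.preimage_mem_nhds hU
  filter_upwards [hopen, hU'] with p hp hpU
  exact (hmem p.1 hpU p.2).2 hp

/-! ### The tangent map and its inverse. -/

namespace TorusDiffeo

variable (f : TorusDiffeo)

theorem continuous_deriv_symm : Continuous fun x => ((f.deriv x).symm : E3 →L[ℝ] E3) := by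
  have h : (fun x => ((f.deriv x).symm : E3 →L[ℝ] E3)) =
      fun x => ContinuousLinearMap.inverse (f.deriv x : E3 →L[ℝ] E3) :=
    funext fun x => (ContinuousLinearMap.inverse_equiv _).symm
  rw [h, continuous_iff_continuousAt]
  intro x
  exact ((contDiffAt_map_inverse (n := 0) (f.deriv x)).continuousAt).comp
    (f := fun x => (f.deriv x : E3 →L[ℝ] E3)) f.continuous_deriv.continuousAt

/-- The tangent map as a homeomorphism of `T𝕋³`. -/
def tangentHomeomorph : TT3 ≃ₜ TT3 where
  toEquiv := f.tangentMap
  continuous_toFun := by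
    refine (f.toHomeomorph.continuous.comp continuous_fst).prodMk ?_
    exact (f.continuous_deriv.comp continuous_fst).clm_apply continuous_snd
  continuous_invFun := by
    refine (f.toHomeomorph.symm.continuous.comp continuous_fst).prodMk ?_
    exact (f.continuous_deriv_symm.comp
      (f.toHomeomorph.symm.continuous.comp continuous_fst)).clm_apply continuous_snd

theorem tangentHomeomorph_apply (x : T3) (v : E3) :
    f.tangentHomeomorph (x, v) = (f x, ((f.deriv x : E3 →L[ℝ] E3) : E3 →ₗ[ℝ] E3) v) := rfl

theorem tangentHomeomorph_symm_apply (x : T3) (v : E3) :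
    f.tangentHomeomorph.symm (x, v) = (f.toHomeomorph.symm x,
      (((f.deriv (f.toHomeomorph.symm x)).symm : E3 →L[ℝ] E3) : E3 →ₗ[ℝ] E3) v) := rfl

variable {f}

theorem isInvariantBundle_iff {E : T3 → Submodule ℝ E3} :
    IsInvariantBundle f E ↔ ∀ x v, f.deriv x v ∈ E (f x) ↔ v ∈ E x := by
  constructor
  · intro h x v
    rw [← h x, Submodule.mem_map]
    constructor
    · rintro ⟨w, hw, e⟩
      rwa [← (f.deriv x).injective e]
    · exact fun hv => ⟨v, hv, rfl⟩
  · intro h x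
    ext v
    rw [Submodule.mem_map]
    constructor
    · rintro ⟨w, hw, rfl⟩
      exact (h x w).2 hw
    · intro hv
      refine ⟨(f.deriv x).symm v, (h x _).1 (by simpa using hv), by simp⟩

/-- If `F` dominates `E` backwards, then it dominates it forwards. -/
theorem isDominatedBy_of_symm {E F : T3 → Submodule ℝ E3}
    (hE : ∀ x v, f.deriv x v ∈ E (f x) ↔ v ∈ E x) (hF : ∀ x v, f.deriv x v ∈ F (f x) ↔ v ∈ F x)
    (h : ∃ K ρ : ℝ, 0 < K ∧ 0 < ρ ∧ ρ < 1 ∧ ∀ (x : T3) (n : ℕ), ∀ v ∈ F x, ∀ w ∈ E x,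
      ‖v‖ = 1 → ‖w‖ = 1 → ‖(f.tangentHomeomorph.symm^[n] (x, v)).2‖ ≤
        K * ρ ^ n * ‖(f.tangentHomeomorph.symm^[n] (x, w)).2‖) :
    IsDominatedBy f E F := by
  obtain ⟨K, ρ, hK, hρ, hρ1, h⟩ := h
  refine ⟨K, ρ, hK, hρ, hρ1, fun x n u hu v hv hu1 hv1 => ?_⟩
  change ‖(f.tangentHomeomorph^[n] (x, u)).2‖ ≤ K * ρ ^ n * ‖(f.tangentHomeomorph^[n] (x, v)).2‖
  obtain ⟨B, hB⟩ := exists_iterate_eq f.tangentHomeomorph_apply n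
  obtain ⟨D, hD⟩ := exists_iterate_eq f.tangentHomeomorph_symm_apply n
  have hinv : ∀ p, f.tangentHomeomorph.symm^[n] (f.tangentHomeomorph^[n] p) = p :=
    Function.LeftInverse.iterate f.tangentHomeomorph.left_inv n
  have hDB : ∀ w, D (f^[n] x) (B x w) = w := fun w => by
    have := hinv (x, w)
    rw [hB, hD] at this
    exact (Prod.mk.inj this).2
  have hBpos : ∀ w, ‖w‖ = 1 → 0 < ‖B x w‖ := fun w hw => by
    rw [norm_pos_iff]
    intro h0
    have := hDB w
    rw [h0, map_zero] at this
    simp [← this] at hw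
  have hBu := hBpos u hu1
  have hBv := hBpos v hv1
  have hBuE : B x u ∈ E (f^[n] x) := by
    have := (mem_iterate_iff f.tangentHomeomorph_apply hE n (x, u)).2 hu
    rwa [hB] at this
  have hBvF : B x v ∈ F (f^[n] x) := by
    have := (mem_iterate_iff f.tangentHomeomorph_apply hF n (x, v)).2 hv
    rwa [hB] at this
  -- The backward estimate is taken at the end of the orbit, for the normalised images of `v` and
  -- `u`, which return to multiples of `v` and `u`.
  have key := h (f^[n] x) n (‖B x v‖⁻¹ • B x v) ((F _).smul_mem _ hBvF) (‖B x u‖⁻¹ • B x u)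
    ((E _).smul_mem _ hBuE)
    (by rw [norm_smul, norm_inv, norm_norm, inv_mul_cancel₀ hBv.ne'])
    (by rw [norm_smul, norm_inv, norm_norm, inv_mul_cancel₀ hBu.ne'])
  rw [hD, hD] at key
  simp only [map_smul, hDB, norm_smul, norm_inv, norm_norm, hu1, hv1, mul_one] at key
  rw [hB, hB]
  calc ‖B x u‖ = ‖B x u‖ * ‖B x v‖ * ‖B x v‖⁻¹ := by field_simp
    _ ≤ ‖B x u‖ * ‖B x v‖ * (K * ρ ^ n * ‖B x u‖⁻¹) := by gcongr
    _ = K * ρ ^ n * ‖B x v‖ := by field_simp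

end TorusDiffeo

/-! ### The dominated splitting. -/

theorem finrank_inf_eq_one {E G : Submodule ℝ E3} (hE : Module.finrank ℝ E = 2)
    (hG : Module.finrank ℝ G = 2) (h : E ⊔ G = ⊤) : Module.finrank ℝ (E ⊓ G : Submodule ℝ E3) = 1 := by
  have := Submodule.finrank_sup_add_finrank_inf_eq E G
  rw [h, finrank_top, hE, hG, finrank_euclideanSpace_fin] at this
  omega

/-- In a plane, a line and a vector off the line span everything. -/
theorem exists_sub_smul_mem {F G : Submodule ℝ E3} (hFG : F ≤ G) (hF : Module.finrank ℝ F = 1)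
    (hG : Module.finrank ℝ G = 2) {w₁ w₂ : E3} (h₁ : w₁ ∈ G) (h₁F : w₁ ∉ F) (h₂ : w₂ ∈ G) :
    ∃ c : ℝ, w₂ - c • w₁ ∈ F := by
  have hlt : F < F ⊔ Submodule.span ℝ {w₁} := by
    refine lt_of_le_of_ne le_sup_left fun h => h₁F ?_
    rw [h]
    exact Submodule.mem_sup_right (Submodule.mem_span_singleton_self w₁)
  have hle : F ⊔ Submodule.span ℝ {w₁} ≤ G :=
    sup_le hFG (by rwa [Submodule.span_le, Set.singleton_subset_iff])
  have heq : F ⊔ Submodule.span ℝ {w₁} = G := by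
    refine Submodule.eq_of_le_of_finrank_le hle ?_
    have := Submodule.finrank_lt_finrank_of_lt hlt
    omega
  rw [← heq, Submodule.mem_sup] at h₂
  obtain ⟨y, hy, z, hz, rfl⟩ := h₂
  obtain ⟨c, rfl⟩ := Submodule.mem_span_singleton.1 hz
  exact ⟨c, by simpa using hy⟩

/-- The cone criterion is used twice with the same line `F`: for `Tf` in `G` and for `Tf⁻¹` in `E`.
The inclusions `E' ≤ E` and `G' ≤ G` are recorded for the Jacobian argument. -/
theorem isDominatedSplitting_of_cones (f : TorusDiffeo) (E G : T3 → Submodule ℝ E3)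
    (hE : IsSubbundle 2 E) (hG : IsSubbundle 2 G)
    (hEinv : IsInvariantBundle f E) (hGinv : IsInvariantBundle f G)
    (hEG : ∀ x, E x ⊔ G x = ⊤)
    (CE CG : Set TT3) (hCE : IsClosedCone CE E) (hCG : IsClosedCone CG G)
    (hCEF : ConeTransverse CE fun x => E x ⊓ G x)
    (hCGF : ConeTransverse CG fun x => E x ⊓ G x)
    (hCGint : f.tangentMap '' CG ⊆ coneInterior CG G)
    (hCEint : f.tangentMap.symm '' CE ⊆ coneInterior CE E) :
    ∃ E' G' : T3 → Submodule ℝ E3,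
      totalSpace E' = ⋂ n : ℕ, f.tangentMap.symm^[n] '' CE ∧
      totalSpace G' = ⋂ n : ℕ, f.tangentMap^[n] '' CG ∧
      IsDominatedSplitting f E' (fun x => E x ⊓ G x) G' ∧
      (∀ x, E' x ≤ E x) ∧ (∀ x, G' x ≤ G x) := by
  have hF1 : ∀ x, Module.finrank ℝ (E x ⊓ G x : Submodule ℝ E3) = 1 := fun x =>
    finrank_inf_eq_one (hE.finrank_eq x) (hG.finrank_eq x) (hEG x)
  have hFcl : IsClosed (totalSpace fun x => E x ⊓ G x) :=
    hE.isClosed_totalSpace.inter hG.isClosed_totalSpace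
  rw [TorusDiffeo.isInvariantBundle_iff] at hEinv hGinv
  have hFinv : ∀ x v, f.deriv x v ∈ E (f x) ⊓ G (f x) ↔ v ∈ E x ⊓ G x := fun x v => by
    rw [Submodule.mem_inf, Submodule.mem_inf, hEinv, hGinv]
  have hFinv' : ∀ x v, (f.deriv (f.toHomeomorph.symm x)).symm v ∈
      E (f.toHomeomorph.symm x) ⊓ G (f.toHomeomorph.symm x) ↔ v ∈ E x ⊓ G x := fun x v => by
    rw [← hFinv]; simp
  obtain ⟨G', hG'tot, hG'cl, hG'G, hFG', hG'1, hG'inv, K, ρ, hK, hρ, hρ1, hdomG⟩ :=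
    exists_line_of_image_subset_coneInterior f.tangentHomeomorph_apply hCG hFcl hCGF
      (fun x => inf_le_right) hFinv
      (fun x w₁ h₁ h₁F w₂ h₂ => exists_sub_smul_mem inf_le_right (hF1 x) (hG.finrank_eq x) h₁ h₁F h₂)
      hCGint
  obtain ⟨E', hE'tot, hE'cl, hE'E, hFE', hE'1, hE'inv, hdomE⟩ :=
    exists_line_of_image_subset_coneInterior f.tangentHomeomorph_symm_apply hCE hFcl hCEF
      (fun x => inf_le_left) hFinv'
      (fun x w₁ h₁ h₁F w₂ h₂ => exists_sub_smul_mem inf_le_left (hF1 x) (hE.finrank_eq x) h₁ h₁F h₂)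
      hCEint
  have hG'inv' : ∀ x v, f.deriv x v ∈ G' (f x) ↔ v ∈ G' x := fun x v => hG'inv (x, v)
  have hE'inv' : ∀ x v, f.deriv x v ∈ E' (f x) ↔ v ∈ E' x := fun x v => by
    have := hE'inv (f.tangentHomeomorph (x, v))
    rw [Homeomorph.symm_apply_apply] at this
    exact this.symm
  refine ⟨E', G', hE'tot, hG'tot, ⟨⟨isSubbundle_one_of_isClosed hE'cl hE'1,
    isSubbundle_one_of_isClosed hFcl hF1, isSubbundle_one_of_isClosed hG'cl hG'1,
    TorusDiffeo.isInvariantBundle_iff.2 hE'inv', TorusDiffeo.isInvariantBundle_iff.2 hFinv,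
    TorusDiffeo.isInvariantBundle_iff.2 hG'inv', hFG', fun x => ?_⟩,
    TorusDiffeo.isDominatedBy_of_symm hE'inv' hFinv hdomE,
    ⟨K, ρ, hK, hρ, hρ1, hdomG⟩⟩, hE'E, hG'G⟩
  have hsupG : (E x ⊓ G x) ⊔ G' x = G x := by
    refine Submodule.eq_of_le_of_finrank_le (sup_le inf_le_right (hG'G x)) ?_
    have := Submodule.finrank_sup_add_finrank_inf_eq (E x ⊓ G x) (G' x)
    rw [(hFG' x).eq_bot, finrank_bot, hF1, hG'1] at this
    rw [hG.finrank_eq]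
    omega
  -- A vector of `E'` in `G` lies in `E ⊓ G`, which meets `E'` trivially.
  have hdisj : Disjoint (E' x) (G x) := by
    rw [Submodule.disjoint_def]
    exact fun v hv hvG => (Submodule.disjoint_def.1 (hFE' x)) v ⟨hE'E x hv, hvG⟩ hv
  simp only [hsupG]
  refine ⟨hdisj, codisjoint_iff.2 ?_⟩
  refine Submodule.eq_top_of_finrank_eq ?_
  have := Submodule.finrank_sup_add_finrank_inf_eq (E' x) (G x)
  rw [hdisj.eq_bot, finrank_bot, hE'1, hG.finrank_eq] at this
  rw [finrank_euclideanSpace_fin]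
  omega

/-! ### Jacobians on planes. -/

theorem norm_apply_eq_normOn_mul (A : E3 →L[ℝ] E3) {W : Submodule ℝ E3}
    (hW : Module.finrank ℝ W = 1) {v : E3} (hv : v ∈ W) : ‖A v‖ = normOn A W * ‖v‖ := by
  obtain ⟨u, hu, hu1⟩ := exists_norm_eq_one_of_finrank_eq_one hW
  have hu0 : u ≠ 0 := fun h => by simp [h] at hu1
  have key : ∀ w ∈ W, ‖A w‖ = ‖A u‖ * ‖w‖ := by
    intro w hw
    obtain ⟨c, rfl⟩ := exists_eq_smul_of_finrank_eq_one hW hu hu0 hw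
    rw [map_smul, norm_smul, norm_smul, hu1, mul_one, mul_comm]
  have : normOn A W = ‖A u‖ := by
    refine le_antisymm (ContinuousLinearMap.opNorm_le_bound _ (norm_nonneg _) fun w => ?_) ?_
    · exact (key w w.2).le
    · simpa [hu1, normOn] using (A.comp W.subtypeL).le_opNorm ⟨u, hu⟩
  rw [this, key v hv]

/-- The quantity is the squared distance from `v` to the line of `u`. -/
theorem one_sub_inner_sq_pos {u v : E3} (hu1 : ‖u‖ = 1) (hv1 : ‖v‖ = 1)
    (huv : LinearIndependent ℝ ![u, v]) : 0 < 1 - inner ℝ u v ^ 2 := by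
  have hne : v - inner ℝ u v • u ≠ 0 := fun h =>
    (LinearIndependent.pair_iff' (fun h => by simp [h] at hu1)).1 huv _ (sub_eq_zero.1 h).symm
  have h := norm_sub_sq_real v (inner ℝ u v • u)
  rw [inner_smul_right, norm_smul, hu1, hv1, real_inner_comm u v, Real.norm_eq_abs, mul_one,
    sq_abs] at h
  have hpos : 0 < ‖v - inner ℝ u v • u‖ ^ 2 := by positivity
  rw [h] at hpos
  linarith

theorem linearIndependent_pair_of_disjoint {V W : Submodule ℝ E3} (h : Disjoint V W) {u v : E3}
    (hu : u ∈ V) (hv : v ∈ W) (hu0 : u ≠ 0) (hv0 : v ≠ 0) : LinearIndependent ℝ ![u, v] := by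
  refine (LinearIndependent.pair_iff' hu0).2 fun c hc => hv0 ?_
  exact Submodule.disjoint_def.1 h v (hc ▸ V.smul_mem c hu) hv

/-- The restriction to a plane scales the Gram determinant by the square of its Jacobian. -/
theorem absDetOn_sq_mul_gram (A : E3 →L[ℝ] E3) {W : Submodule ℝ E3}
    (hW : Module.finrank ℝ W = 2) {u v : E3} (hu : u ∈ W) (hv : v ∈ W) (hu1 : ‖u‖ = 1)
    (hv1 : ‖v‖ = 1) (huv : LinearIndependent ℝ ![u, v]) :
    absDetOn A W ^ 2 * (1 - inner ℝ u v ^ 2) =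
      ‖A u‖ ^ 2 * ‖A v‖ ^ 2 - inner ℝ (A u) (A v) ^ 2 := by
  set B : W →L[ℝ] W := (ContinuousLinearMap.adjoint (A.comp W.subtypeL)).comp (A.comp W.subtypeL)
    with hB
  have hli : LinearIndependent ℝ ![(⟨u, hu⟩ : W), ⟨v, hv⟩] := by
    refine LinearIndependent.of_comp W.subtype ?_
    convert huv using 1
    ext i : 1
    fin_cases i <;> rfl
  set b : Module.Basis (Fin 2) ℝ W :=
    basisOfLinearIndependentOfCardEqFinrank hli (by simp [hW]) with hb
  have hb0 : b 0 = ⟨u, hu⟩ := by simp [hb]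
  have hb1 : b 1 = ⟨v, hv⟩ := by simp [hb]
  set M := LinearMap.toMatrix b b (B : W →ₗ[ℝ] W) with hM
  have hdet : LinearMap.det (B : W →ₗ[ℝ] W) = M 0 0 * M 1 1 - M 0 1 * M 1 0 := by
    rw [← LinearMap.det_toMatrix b, ← hM, Matrix.det_fin_two]
  have hcol : ∀ j, (B (b j) : E3) = M 0 j • u + M 1 j • v := by
    intro j
    have := congrArg Subtype.val (b.sum_repr (B (b j))).symm
    rw [Fin.sum_univ_two, hb0, hb1] at this
    simpa [hM, LinearMap.toMatrix_apply] using this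
  have hinner : ∀ w z : W, inner ℝ (w : E3) (B z) = inner ℝ (A w) (A z) := by
    intro w z
    rw [hB, ← Submodule.coe_inner, ContinuousLinearMap.comp_apply,
      ContinuousLinearMap.adjoint_inner_right]
    rfl
  -- These four relations say that the Gram matrix of `(A u, A v)` is the Gram matrix of `(u, v)`
  -- times `M`; the claim is the identity of determinants.
  have h00 := hinner (b 0) (b 0)
  have h01 := hinner (b 0) (b 1)
  have h10 := hinner (b 1) (b 0)
  have h11 := hinner (b 1) (b 1)
  rw [hcol, inner_add_right, inner_smul_right, inner_smul_right] at h00 h01 h10 h11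
  simp only [hb0, hb1, real_inner_self_eq_norm_sq, hu1, hv1] at h00 h01 h10 h11
  rw [real_inner_comm u v, real_inner_comm (A u) (A v)] at h10
  rw [real_inner_comm u v] at h11
  have hgram : LinearMap.det (B : W →ₗ[ℝ] W) * (1 - inner ℝ u v ^ 2) =
      ‖A u‖ ^ 2 * ‖A v‖ ^ 2 - inner ℝ (A u) (A v) ^ 2 := by
    rw [hdet]
    linear_combination ‖A v‖ ^ 2 * h00 + (M 0 0 + M 1 0 * inner ℝ u v) * h11 -
      inner ℝ (A u) (A v) * h10 - (M 0 0 * inner ℝ u v + M 1 0) * h01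
  have hpos := one_sub_inner_sq_pos hu1 hv1 huv
  -- Needed to undo the square root in `absDetOn`; the sign comes from Cauchy–Schwarz for `A u` and
  -- `A v`.
  have hnonneg : 0 ≤ LinearMap.det (B : W →ₗ[ℝ] W) := by
    have h1 := abs_real_inner_le_norm (A u) (A v)
    have h2 := sq_le_sq' (by linarith [neg_abs_le (inner ℝ (A u) (A v))])
      ((le_abs_self _).trans h1)
    rw [mul_pow] at h2
    exact nonneg_of_mul_nonneg_left (hgram ▸ sub_nonneg.2 h2) hpos
  rw [absDetOn, Real.sq_sqrt hnonneg, hgram]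

/-! ### Growth rates along invariant lines. -/

/-- An invariant line bundle, seen as a family of lines with closed total space. -/
structure IsInvariantLineField (f : TorusDiffeo) (L : T3 → Submodule ℝ E3) : Prop where
  isClosed : IsClosed (totalSpace L)
  finrank_eq_one : ∀ x, Module.finrank ℝ (L x) = 1
  deriv_mem_iff : ∀ x v, f.deriv x v ∈ L (f x) ↔ v ∈ L x

theorem IsSubbundle.isInvariantLineField {f : TorusDiffeo} {L : T3 → Submodule ℝ E3}
    (hL : IsSubbundle 1 L) (hinv : IsInvariantBundle f L) : IsInvariantLineField f L :=
  ⟨hL.isClosed_totalSpace, hL.finrank_eq, TorusDiffeo.isInvariantBundle_iff.1 hinv⟩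

/-- The product of `σ` along the first `n` points of an orbit. -/
def orbitProd (f : TorusDiffeo) (σ : T3 → ℝ) (n : ℕ) (x : T3) : ℝ :=
  ∏ j ∈ Finset.range n, σ (f^[j] x)

section Rates

variable {f : TorusDiffeo} {L L₁ L₂ : T3 → Submodule ℝ E3}

theorem IsInvariantLineField.exists_unit (hL : IsInvariantLineField f L) (x : T3) :
    ∃ u ∈ L x, ‖u‖ = 1 := exists_norm_eq_one_of_finrank_eq_one (hL.finrank_eq_one x)

theorem IsInvariantLineField.norm_deriv (hL : IsInvariantLineField f L) {x : T3} {v : E3}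
    (hv : v ∈ L x) : ‖f.deriv x v‖ = normOn (f.deriv x) (L x) * ‖v‖ :=
  norm_apply_eq_normOn_mul (f.deriv x : E3 →L[ℝ] E3) (hL.finrank_eq_one x) hv

theorem IsInvariantLineField.normOn_pos (hL : IsInvariantLineField f L) (x : T3) :
    0 < normOn (f.deriv x) (L x) := by
  obtain ⟨u, hu, hu1⟩ := hL.exists_unit x
  have h := hL.norm_deriv hu
  rw [hu1, mul_one] at h
  rw [← h, norm_pos_iff]
  intro h0
  rw [(f.deriv x).map_eq_zero_iff] at h0
  simp [h0] at hu1

/-- Over the unit vectors of `L` the rate is the norm of the tangent map, which does not see the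
sign. -/
theorem IsInvariantLineField.continuous_normOn (hL : IsInvariantLineField f L) :
    Continuous fun x => normOn (f.deriv x) (L x) := by
  refine continuous_of_comp_isCompact (isCompact_sphereBundle hL.isClosed) continuous_fst
    (fun x => let ⟨u, hu, hu1⟩ := hL.exists_unit x; ⟨(x, u), ⟨hu, hu1⟩, rfl⟩)
    (φ := fun p : TT3 => ‖(f.tangentHomeomorph p).2‖)
    (continuous_snd.comp f.tangentHomeomorph.continuous).norm.continuousOn ?_
  rintro ⟨x, v⟩ ⟨hv, hv1⟩
  have := hL.norm_deriv hv
  simp only at hv1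
  rw [hv1, mul_one] at this
  exact this.symm

theorem orbitProd_zero (σ : T3 → ℝ) (x : T3) : orbitProd f σ 0 x = 1 := by simp [orbitProd]

theorem orbitProd_succ (σ : T3 → ℝ) (n : ℕ) (x : T3) :
    orbitProd f σ (n + 1) x = orbitProd f σ n x * σ (f^[n] x) := Finset.prod_range_succ _ _

theorem orbitProd_succ' (σ : T3 → ℝ) (n : ℕ) (x : T3) :
    orbitProd f σ (n + 1) x = σ x * orbitProd f σ n (f x) := by
  rw [orbitProd, Finset.prod_range_succ', mul_comm]; rfl

theorem orbitProd_pos {σ : T3 → ℝ} (hσ : ∀ x, 0 < σ x) (n : ℕ) (x : T3) : 0 < orbitProd f σ n x :=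
  Finset.prod_pos fun _ _ => hσ _

theorem continuous_orbitProd {σ : T3 → ℝ} (hσ : Continuous σ) (n : ℕ) :
    Continuous (orbitProd f σ n) :=
  continuous_finsetProd _ fun j _ => hσ.comp (f.toHomeomorph.continuous.iterate j)

theorem IsInvariantLineField.norm_iterate (hL : IsInvariantLineField f L) (n : ℕ) {x : T3} {v : E3}
    (hv : v ∈ L x) : ‖(f.tangentMap^[n] (x, v)).2‖ =
      orbitProd f (fun x => normOn (f.deriv x) (L x)) n x * ‖v‖ := by
  induction n with
  | zero => simp [orbitProd_zero]
  | succ n ih =>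
    have h1 : f.tangentMap^[n] (x, v) ∈ totalSpace L :=
      (mem_iterate_iff f.tangentHomeomorph_apply hL.deriv_mem_iff n (x, v)).2 hv
    have h2 : (f.tangentMap^[n] (x, v)).1 = f^[n] x :=
      iterate_fst f.tangentHomeomorph_apply n (x, v)
    rw [Function.iterate_succ_apply', orbitProd_succ]
    refine (hL.norm_deriv h1).trans ?_
    rw [ih, h2]
    ring

theorem exists_pos_le_of_continuous {φ : T3 → ℝ} (hφ : Continuous φ) (hpos : ∀ x, 0 < φ x) :
    ∃ m, 0 < m ∧ ∀ x, m ≤ φ x := by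
  obtain ⟨x, -, hx⟩ := isCompact_univ.exists_isMinOn Set.univ_nonempty hφ.continuousOn
  exact ⟨φ x, hpos x, fun y => hx (Set.mem_univ y)⟩

/-- A cocycle that is smaller than a coboundary is eventually contracting. -/
theorem eventually_orbitProd_lt_one {σ Γ : T3 → ℝ} (hσ : Continuous σ) (hΓ : Continuous Γ)
    (hσ0 : ∀ x, 0 < σ x) (hΓ0 : ∀ x, 0 < Γ x) (h : ∀ x, σ x ^ 2 * Γ (f x) < Γ x) :
    ∀ᶠ n in Filter.atTop, ∀ x, orbitProd f σ n x < 1 := by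
  obtain ⟨m, hm, hmle⟩ := exists_pos_le_of_continuous hΓ hΓ0
  have hfc : Continuous (f : T3 → T3) := f.toHomeomorph.continuous
  obtain ⟨x₀, -, hx₀⟩ := isCompact_univ.exists_isMaxOn Set.univ_nonempty
    (f := fun x => σ x ^ 2 * Γ (f x) / Γ x)
    (((hσ.pow 2).mul (hΓ.comp hfc)).div hΓ fun x => (hΓ0 x).ne').continuousOn
  obtain ⟨x₁, -, hx₁⟩ := isCompact_univ.exists_isMaxOn Set.univ_nonempty hΓ.continuousOn
  -- The maximum of the quotient over the compact torus, hence a uniform rate below 1. The factors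
  -- `Γ` telescope along orbits and are finally bounded by their extrema.
  set κ := σ x₀ ^ 2 * Γ (f x₀) / Γ x₀ with hκ
  have hκ0 : 0 < κ := div_pos (mul_pos (pow_pos (hσ0 _) 2) (hΓ0 _)) (hΓ0 _)
  have hκ1 : κ < 1 := (div_lt_one (hΓ0 _)).2 (h x₀)
  have hstep : ∀ x, σ x ^ 2 * Γ (f x) ≤ κ * Γ x := fun x =>
    (div_le_iff₀ (hΓ0 x)).1 (hx₀ (Set.mem_univ x))
  have hiter : ∀ n x, orbitProd f σ n x ^ 2 * Γ (f^[n] x) ≤ κ ^ n * Γ x := by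
    intro n
    induction n with
    | zero => intro x; simp [orbitProd_zero]
    | succ n ih =>
      intro x
      rw [orbitProd_succ', mul_pow, Function.iterate_succ_apply]
      calc σ x ^ 2 * orbitProd f σ n (f x) ^ 2 * Γ (f^[n] (f x))
          = σ x ^ 2 * (orbitProd f σ n (f x) ^ 2 * Γ (f^[n] (f x))) := by ring
        _ ≤ σ x ^ 2 * (κ ^ n * Γ (f x)) :=
          mul_le_mul_of_nonneg_left (ih (f x)) (sq_nonneg _)
        _ = κ ^ n * (σ x ^ 2 * Γ (f x)) := by ring
        _ ≤ κ ^ n * (κ * Γ x) :=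
          mul_le_mul_of_nonneg_left (hstep x) (pow_nonneg hκ0.le n)
        _ = κ ^ (n + 1) * Γ x := by ring
  have htend := (tendsto_pow_atTop_nhds_zero_of_lt_one hκ0.le hκ1).mul_const (Γ x₁)
  rw [zero_mul] at htend
  filter_upwards [htend.eventually_lt_const hm] with n hn x
  have h1 : orbitProd f σ n x ^ 2 * m < 1 * m := by
    calc orbitProd f σ n x ^ 2 * m ≤ orbitProd f σ n x ^ 2 * Γ (f^[n] x) := by
          gcongr; exact hmle _
      _ ≤ κ ^ n * Γ x := hiter n x
      _ ≤ κ ^ n * Γ x₁ := by gcongr; exact hx₁ (Set.mem_univ x)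
      _ < 1 * m := by rw [one_mul]; exact hn
  have h2 := lt_of_mul_lt_mul_right h1 hm.le
  exact (sq_lt_one_iff₀ (orbitProd_pos hσ0 n x).le).1 h2

/-- This is the contracting case for `σ⁻¹` and `Γ⁻¹`. -/
theorem eventually_one_lt_orbitProd {σ Γ : T3 → ℝ} (hσ : Continuous σ) (hΓ : Continuous Γ)
    (hσ0 : ∀ x, 0 < σ x) (hΓ0 : ∀ x, 0 < Γ x) (h : ∀ x, Γ x < σ x ^ 2 * Γ (f x)) :
    ∀ᶠ n in Filter.atTop, ∀ x, 1 < orbitProd f σ n x := by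
  have := eventually_orbitProd_lt_one (f := f)
    (σ := fun x => (σ x)⁻¹) (Γ := fun x => (Γ x)⁻¹) (hσ.inv₀ fun x => (hσ0 x).ne')
    (hΓ.inv₀ fun x => (hΓ0 x).ne') (fun x => inv_pos.2 (hσ0 x)) (fun x => inv_pos.2 (hΓ0 x))
    (fun x => by
      simp only [inv_pow, ← mul_inv]
      exact (inv_lt_inv₀ (mul_pos (pow_pos (hσ0 x) 2) (hΓ0 _)) (hΓ0 x)).2 (h x))
  filter_upwards [this] with n hn x
  have h1 : orbitProd f (fun x => (σ x)⁻¹) n x = (orbitProd f σ n x)⁻¹ := Finset.prod_inv_distrib _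
  have h2 := hn x
  rw [h1] at h2
  exact (inv_lt_one_iff₀.1 h2).resolve_left (not_le.2 (orbitProd_pos hσ0 n x))

/-- The squared sine of the angle between two transverse line fields. -/
theorem exists_sq_sin_angle (hL₁ : IsInvariantLineField f L₁) (hL₂ : IsInvariantLineField f L₂)
    (hdisj : ∀ x, Disjoint (L₁ x) (L₂ x)) :
    ∃ Γ : T3 → ℝ, Continuous Γ ∧ (∀ x, 0 < Γ x) ∧ ∀ x, ∀ u ∈ L₁ x, ∀ v ∈ L₂ x,
      Γ x * (‖u‖ ^ 2 * ‖v‖ ^ 2) = ‖u‖ ^ 2 * ‖v‖ ^ 2 - inner ℝ u v ^ 2 := by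
  choose u huL hu1 using hL₁.exists_unit
  choose v hvL hv1 using hL₂.exists_unit
  have hne : ∀ {w : E3}, ‖w‖ = 1 → w ≠ 0 := fun h h0 => by simp [h0] at h
  have hval : ∀ x, ∀ u' ∈ L₁ x, ∀ v' ∈ L₂ x, (1 - inner ℝ (u x) (v x) ^ 2) *
      (‖u'‖ ^ 2 * ‖v'‖ ^ 2) = ‖u'‖ ^ 2 * ‖v'‖ ^ 2 - inner ℝ u' v' ^ 2 := by
    intro x u' hu' v' hv'
    obtain ⟨c, rfl⟩ := exists_eq_smul_of_finrank_eq_one (hL₁.finrank_eq_one x) (huL x)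
      (hne (hu1 x)) hu'
    obtain ⟨d, rfl⟩ := exists_eq_smul_of_finrank_eq_one (hL₂.finrank_eq_one x) (hvL x)
      (hne (hv1 x)) hv'
    rw [norm_smul, norm_smul, hu1, hv1, inner_smul_left, inner_smul_right]
    simp only [Real.norm_eq_abs, mul_one, sq_abs, conj_trivial]
    ring
  refine ⟨fun x => 1 - inner ℝ (u x) (v x) ^ 2, ?_, fun x => one_sub_inner_sq_pos (hu1 x) (hv1 x)
    (linearIndependent_pair_of_disjoint (hdisj x) (huL x) (hvL x) (hne (hu1 x)) (hne (hv1 x))),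
    hval⟩
  -- Continuity is tested on pairs of unit vectors over a common point; the square of the inner
  -- product ignores both signs.
  refine continuous_of_comp_isCompact (((isCompact_sphereBundle hL₁.isClosed).prod
    (isCompact_sphereBundle hL₂.isClosed)).inter_right
      (isClosed_eq (f := fun q : TT3 × TT3 => q.1.1) (g := fun q => q.2.1) (by fun_prop)
        (by fun_prop))) (π := fun q : TT3 × TT3 => q.1.1) (by fun_prop)
    (fun x => ⟨((x, u x), (x, v x)), ⟨⟨⟨huL x, hu1 x⟩, ⟨hvL x, hv1 x⟩⟩, rfl⟩, rfl⟩)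
    (φ := fun q => 1 - inner ℝ q.1.2 q.2.2 ^ 2) (by fun_prop) ?_
  rintro ⟨⟨x, u'⟩, ⟨y, v'⟩⟩ ⟨⟨⟨hu, hu'⟩, ⟨hv, hv'⟩⟩, hxy⟩
  obtain rfl : x = y := hxy
  have := hval x u' hu v' hv
  simp only at hu' hv'
  simpa [hu', hv'] using this

/-- The area of a parallelogram with sides in the two lines is the product of the sides and the sine
of the angle; this compares such areas before and after `Tf`, in squared form. -/
theorem absDetOn_sq_mul_eq (hL₁ : IsInvariantLineField f L₁) (hL₂ : IsInvariantLineField f L₂)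
    (hdisj : ∀ x, Disjoint (L₁ x) (L₂ x)) {E : T3 → Submodule ℝ E3}
    (hE : ∀ x, Module.finrank ℝ (E x) = 2) (h₁ : ∀ x, L₁ x ≤ E x) (h₂ : ∀ x, L₂ x ≤ E x) {Γ : T3 → ℝ}
    (hΓ : ∀ x, ∀ u ∈ L₁ x, ∀ v ∈ L₂ x,
      Γ x * (‖u‖ ^ 2 * ‖v‖ ^ 2) = ‖u‖ ^ 2 * ‖v‖ ^ 2 - inner ℝ u v ^ 2) (x : T3) :
    absDetOn (f.deriv x) (E x) ^ 2 * Γ x =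
      normOn (f.deriv x) (L₁ x) ^ 2 * Γ (f x) * normOn (f.deriv x) (L₂ x) ^ 2 := by
  obtain ⟨u, hu, hu1⟩ := hL₁.exists_unit x
  obtain ⟨v, hv, hv1⟩ := hL₂.exists_unit x
  have hne : ∀ {w : E3}, ‖w‖ = 1 → w ≠ 0 := fun h h0 => by simp [h0] at h
  have h := absDetOn_sq_mul_gram (f.deriv x : E3 →L[ℝ] E3) (hE x) (h₁ x hu) (h₂ x hv) hu1 hv1
    (linearIndependent_pair_of_disjoint (hdisj x) hu hv (hne hu1) (hne hv1))
  have h3 := hΓ x u hu v hv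
  rw [hu1, hv1] at h3
  have h4 := hΓ (f x) _ ((hL₁.deriv_mem_iff x u).2 hu) _ ((hL₂.deriv_mem_iff x v).2 hv)
  simp only [one_pow, mul_one] at h3
  rw [h3, h]
  refine h4.symm.trans ?_
  rw [hL₁.norm_deriv hu, hL₂.norm_deriv hv, hu1, hv1]
  ring

/-- If the area in a plane bundle grows less than the length in one of two invariant lines, then
the other line is eventually contracted. -/
theorem eventually_contracting (hL₁ : IsInvariantLineField f L₁) (hL₂ : IsInvariantLineField f L₂)
    (hdisj : ∀ x, Disjoint (L₁ x) (L₂ x)) {E : T3 → Submodule ℝ E3}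
    (hE : ∀ x, Module.finrank ℝ (E x) = 2) (h₁ : ∀ x, L₁ x ≤ E x) (h₂ : ∀ x, L₂ x ≤ E x)
    (h : ∀ x, absDetOn (f.deriv x) (E x) < normOn (f.deriv x) (L₂ x)) :
    ∀ᶠ n in Filter.atTop, ∀ x, orbitProd f (fun x => normOn (f.deriv x) (L₁ x)) n x < 1 := by
  obtain ⟨Γ, hΓc, hΓ0, hΓ⟩ := exists_sq_sin_angle hL₁ hL₂ hdisj
  refine eventually_orbitProd_lt_one hL₁.continuous_normOn hΓc hL₁.normOn_pos hΓ0 fun x => ?_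
  have h1 := absDetOn_sq_mul_eq hL₁ hL₂ hdisj hE h₁ h₂ hΓ x
  have h2 : absDetOn (f.deriv x) (E x) ^ 2 < normOn (f.deriv x) (L₂ x) ^ 2 :=
    pow_lt_pow_left₀ (h x) (Real.sqrt_nonneg _) two_ne_zero
  refine lt_of_mul_lt_mul_right (a := normOn (f.deriv x) (L₂ x) ^ 2) ?_ (sq_nonneg _)
  rw [← h1, mul_comm (Γ x)]
  exact mul_lt_mul_of_pos_right h2 (hΓ0 x)

theorem eventually_expanding (hL₁ : IsInvariantLineField f L₁) (hL₂ : IsInvariantLineField f L₂)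
    (hdisj : ∀ x, Disjoint (L₁ x) (L₂ x)) {E : T3 → Submodule ℝ E3}
    (hE : ∀ x, Module.finrank ℝ (E x) = 2) (h₁ : ∀ x, L₁ x ≤ E x) (h₂ : ∀ x, L₂ x ≤ E x)
    (h : ∀ x, normOn (f.deriv x) (L₂ x) < absDetOn (f.deriv x) (E x)) :
    ∀ᶠ n in Filter.atTop, ∀ x, 1 < orbitProd f (fun x => normOn (f.deriv x) (L₁ x)) n x := by
  obtain ⟨Γ, hΓc, hΓ0, hΓ⟩ := exists_sq_sin_angle hL₁ hL₂ hdisj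
  refine eventually_one_lt_orbitProd hL₁.continuous_normOn hΓc hL₁.normOn_pos hΓ0 fun x => ?_
  have h1 := absDetOn_sq_mul_eq hL₁ hL₂ hdisj hE h₁ h₂ hΓ x
  have h2 : normOn (f.deriv x) (L₂ x) ^ 2 < absDetOn (f.deriv x) (E x) ^ 2 :=
    pow_lt_pow_left₀ (h x) (hL₂.normOn_pos x).le two_ne_zero
  refine lt_of_mul_lt_mul_right (a := normOn (f.deriv x) (L₂ x) ^ 2) ?_ (sq_nonneg _)
  rw [← h1, mul_comm (Γ x)]
  exact mul_lt_mul_of_pos_right h2 (hΓ0 x)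

theorem IsDominatedBy.eventually_orbitProd_lt (hL₁ : IsInvariantLineField f L₁)
    (hL₂ : IsInvariantLineField f L₂) (h : IsDominatedBy f L₁ L₂) :
    ∀ᶠ n in Filter.atTop, ∀ x, orbitProd f (fun x => normOn (f.deriv x) (L₁ x)) n x <
      orbitProd f (fun x => normOn (f.deriv x) (L₂ x)) n x := by
  obtain ⟨C, ρ, hC, hρ, hρ1, h⟩ := h
  have htend := (tendsto_pow_atTop_nhds_zero_of_lt_one hρ.le hρ1).const_mul C
  rw [mul_zero] at htend
  filter_upwards [htend.eventually_lt_const one_pos] with n hn x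
  obtain ⟨u, hu, hu1⟩ := hL₁.exists_unit x
  obtain ⟨v, hv, hv1⟩ := hL₂.exists_unit x
  have h1 := h x n u hu v hv hu1 hv1
  rw [hL₁.norm_iterate n hu, hL₂.norm_iterate n hv, hu1, hv1, mul_one, mul_one] at h1
  calc _ ≤ _ := h1
    _ < 1 * _ := mul_lt_mul_of_pos_right hn (orbitProd_pos hL₂.normOn_pos n x)
    _ = _ := one_mul _

/-- Averaging along orbits: a positive cocycle is cohomologous to the geometric mean of its first
`N` translates. -/
theorem exists_cohomologous_geom_mean {σ : T3 → ℝ} (hσ : Continuous σ) (hσ0 : ∀ x, 0 < σ x) {N : ℕ}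
    (hN : N ≠ 0) : ∃ a : T3 → ℝ, Continuous a ∧ (∀ x, 0 < a x) ∧
      ∀ x, (σ x * a (f x) / a x) ^ N = orbitProd f σ N x := by
  have hpos : ∀ x, 0 < ∏ k ∈ Finset.range N, orbitProd f σ k x := fun x =>
    Finset.prod_pos fun k _ => orbitProd_pos hσ0 k x
  refine ⟨fun x => (∏ k ∈ Finset.range N, orbitProd f σ k x) ^ (N⁻¹ : ℝ), ?_,
    fun x => Real.rpow_pos_of_pos (hpos x) _, fun x => ?_⟩
  · exact (continuous_finsetProd _ fun k _ => continuous_orbitProd hσ k).rpow_const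
      fun x => Or.inl (hpos x).ne'
  · rw [div_pow, mul_pow, Real.rpow_inv_natCast_pow (hpos _).le hN,
      Real.rpow_inv_natCast_pow (hpos _).le hN, div_eq_iff (hpos x).ne']
    have h1 : ∏ k ∈ Finset.range N, orbitProd f σ (k + 1) x =
        σ x ^ N * ∏ k ∈ Finset.range N, orbitProd f σ k (f x) := by
      rw [Finset.prod_congr rfl fun k _ => orbitProd_succ' σ k x, Finset.prod_mul_distrib,
        Finset.prod_const, Finset.card_range]
    -- Both sides become the product over `k ≤ N`, since the factor for `k = 0` is 1.
    rw [← h1, mul_comm, ← Finset.prod_range_succ, Finset.prod_range_succ', orbitProd_zero, mul_one]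

end Rates

/-! ### Smooth approximation of Riemannian metrics. -/

theorem contDiff_mFourier_torusProj (n : Fin 3 → ℤ) :
    ContDiff ℝ ∞ fun p : E3 => UnitAddTorus.mFourier n (torusProj p) := by
  have h : (fun p : E3 => UnitAddTorus.mFourier n (torusProj p)) =
      fun p : E3 => ∏ i, Complex.exp (2 * Real.pi * Complex.I * n i * (p i : ℝ) / (1 : ℝ)) := by
    ext p
    simp only [UnitAddTorus.mFourier, ContinuousMap.coe_mk, torusProj]
    exact Finset.prod_congr rfl fun i _ => fourier_coe_apply
  rw [h]
  refine contDiff_prod fun i _ => ContDiff.cexp ?_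
  have h1 : ContDiff ℝ ∞ fun p : E3 => ((p i : ℝ) : ℂ) :=
    Complex.ofRealCLM.contDiff.comp (EuclideanSpace.proj (𝕜 := ℝ) i).contDiff
  exact (contDiff_const.mul h1).div_const _

/-- Continuous functions on the torus are uniform limits of smooth ones. -/
theorem exists_contDiff_torusProj_abs_sub_le {φ : T3 → ℝ} (hφ : Continuous φ) {ε : ℝ}
    (hε : 0 < ε) :
    ∃ h : T3 → ℝ, (ContDiff ℝ ∞ fun p : E3 => h (torusProj p)) ∧ ∀ x, |h x - φ x| ≤ ε := by
  set Φ : C(T3, ℂ) := ⟨fun x => (φ x : ℂ), by fun_prop⟩ with hΦ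
  -- Trigonometric polynomials are dense; passing to the real part keeps smoothness and does not
  -- increase the error.
  have hmem : Φ ∈ (Submodule.span ℂ (Set.range
      (UnitAddTorus.mFourier (d := Fin 3)))).topologicalClosure := by
    rw [UnitAddTorus.span_mFourier_closure_eq_top]; trivial
  obtain ⟨Ψ, hΨ, hdist⟩ := Metric.mem_closure_iff.1 hmem ε hε
  have hsmooth : ContDiff ℝ ∞ fun p : E3 => Ψ (torusProj p) := by
    refine Submodule.span_induction (p := fun Ψ _ => ContDiff ℝ ∞ fun p : E3 => Ψ (torusProj p))
      ?_ ?_ ?_ ?_ hΨ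
    · rintro _ ⟨n, rfl⟩
      exact contDiff_mFourier_torusProj n
    · exact contDiff_const
    · exact fun _ _ _ _ h1 h2 => h1.add h2
    · exact fun c _ _ h => contDiff_const.mul h
  refine ⟨fun x => (Ψ x).re, Complex.reCLM.contDiff.comp hsmooth, fun x => ?_⟩
  have h1 := (ContinuousMap.dist_lt_iff hε).1 hdist x
  rw [dist_comm, Complex.dist_eq] at h1
  have h2 := Complex.abs_re_le_norm (Ψ x - Φ x)
  rw [Complex.sub_re] at h2
  exact h2.trans h1.le

theorem abs_coord_le_norm (v : E3) (i : Fin 3) : |v i| ≤ ‖v‖ := PiLp.norm_apply_le v i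

/-- Continuous Riemannian metrics can be approximated by smooth ones. -/
theorem exists_torusRiemannianMetric_close (g : T3 → E3 →ₗ[ℝ] E3 →ₗ[ℝ] ℝ)
    (hg : ∀ v w, Continuous fun x => g x v w) (hsymm : ∀ x v w, g x v w = g x w v) {m : ℝ}
    (hm : 0 < m) (hpos : ∀ x v, m * ‖v‖ ^ 2 ≤ g x v v) {δ : ℝ} (hδ : 0 < δ) (hδ1 : δ < 1) :
    ∃ G : TorusRiemannianMetric, ∀ x v,
      (1 - δ) * g x v v ≤ G.inner x v v ∧ G.inner x v v ≤ (1 + δ) * g x v v := by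
  set e : Fin 3 → E3 := fun i => EuclideanSpace.single i 1 with he
  -- Nine coefficients with error `δ * m / 9` change the form by at most `δ * m * ‖v‖ ^ 2`. They are
  -- approximated separately, so symmetry is restored below by averaging `h i j` and `h j i`.
  choose h hsmooth hclose using fun i j : Fin 3 =>
    exists_contDiff_torusProj_abs_sub_le (hg (e i) (e j)) (by positivity : 0 < δ * m / 9)
  set B : T3 → E3 →L[ℝ] E3 →L[ℝ] ℝ := fun x => ∑ i, ∑ j, ((h i j x + h j i x) / 2) •
    (EuclideanSpace.proj i : E3 →L[ℝ] ℝ).smulRight (EuclideanSpace.proj j : E3 →L[ℝ] ℝ) with hB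
  have hBapply : ∀ x v w, B x v w = ∑ i, ∑ j, (h i j x + h j i x) / 2 * (v i * w j) := by
    intro x v w
    simp [hB]
  have hgapply : ∀ x v w, g x v w = ∑ i, ∑ j, g x (e i) (e j) * (v i * w j) := by
    intro x v w
    have hsum : ∀ v : E3, v = ∑ i, v i • e i := fun v => by
      have := (EuclideanSpace.basisFun (Fin 3) ℝ).sum_repr v
      simpa [he] using this.symm
    conv_lhs => rw [hsum v, hsum w]
    simp only [map_sum, LinearMap.sum_apply, map_smul, LinearMap.smul_apply, smul_eq_mul]
    rw [Finset.sum_comm]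
    refine Finset.sum_congr rfl fun i _ => ?_
    rw [Finset.mul_sum]
    exact Finset.sum_congr rfl fun j _ => by rw [hsymm]; ring
  have hdiff : ∀ x v, |B x v v - g x v v| ≤ δ * g x v v := by
    intro x v
    rw [hBapply, hgapply x v v, ← hgapply x v v]
    calc |∑ i, ∑ j, (h i j x + h j i x) / 2 * (v i * v j) - g x v v|
        = |∑ i, ∑ j, ((h i j x + h j i x) / 2 - g x (e i) (e j)) * (v i * v j)| := by
          rw [hgapply x v v]
          simp only [sub_mul, Finset.sum_sub_distrib]
      _ ≤ ∑ i : Fin 3, ∑ j : Fin 3, δ * m / 9 * (‖v‖ * ‖v‖) := by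
          refine (Finset.abs_sum_le_sum_abs _ _).trans (Finset.sum_le_sum fun i _ => ?_)
          refine (Finset.abs_sum_le_sum_abs _ _).trans (Finset.sum_le_sum fun j _ => ?_)
          rw [abs_mul, abs_mul]
          have h1 : |(h i j x + h j i x) / 2 - g x (e i) (e j)| ≤ δ * m / 9 := by
            have h2 := abs_le.1 (hclose i j x)
            have h3 := abs_le.1 (hclose j i x)
            rw [hsymm x (e j)] at h3
            rw [abs_le]
            constructor <;> linarith [h2.1, h2.2, h3.1, h3.2]
          gcongr
          · exact abs_coord_le_norm v i
          · exact abs_coord_le_norm v j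
      _ = δ * (m * ‖v‖ ^ 2) := by
          simp only [Finset.sum_const, Finset.card_univ, Fintype.card_fin, nsmul_eq_mul]
          push_cast; ring
      _ ≤ δ * g x v v := by gcongr; exact hpos x v
  have hle : ∀ x v, (1 - δ) * g x v v ≤ B x v v ∧ B x v v ≤ (1 + δ) * g x v v := fun x v => by
    have := abs_le.1 (hdiff x v)
    constructor <;> linarith [this.1, this.2]
  refine ⟨⟨B, fun x v w => ?_, fun x v hv => ?_, ?_⟩, hle⟩
  · rw [hBapply, hBapply, Finset.sum_comm]
    refine Finset.sum_congr rfl fun i _ => Finset.sum_congr rfl fun j _ => by ring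
  · have h1 : 0 < m * ‖v‖ ^ 2 := mul_pos hm (pow_pos (norm_pos_iff.2 hv) 2)
    have h2 := h1.trans_le (hpos x v)
    exact (mul_pos (by linarith) h2).trans_le (hle x v).1
  · refine contDiff_clm_apply_iff.2 fun v => contDiff_clm_apply_iff.2 fun w => ?_
    simp only [hBapply]
    refine ContDiff.sum fun i _ => ContDiff.sum fun j _ => ?_
    exact (((hsmooth i j).add (hsmooth j i)).div_const 2).mul contDiff_const

/-- Three independent line fields are orthogonal for a continuous Riemannian metric, with prescribed
lengths. -/
theorem exists_orthogonal_metric {f : TorusDiffeo} {L : Fin 3 → T3 → Submodule ℝ E3}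
    (hL : ∀ i, IsInvariantLineField f (L i))
    (hli : ∀ x (s : Fin 3 → E3), (∀ i, s i ∈ L i x) → (∀ i, s i ≠ 0) → LinearIndependent ℝ s)
    {a : Fin 3 → T3 → ℝ} (ha : ∀ i, Continuous (a i)) (ha0 : ∀ i x, 0 < a i x) :
    ∃ g : T3 → E3 →ₗ[ℝ] E3 →ₗ[ℝ] ℝ, (∀ v w, Continuous fun x => g x v w) ∧
      (∀ x v w, g x v w = g x w v) ∧ (∃ m, 0 < m ∧ ∀ x v, m * ‖v‖ ^ 2 ≤ g x v v) ∧
      ∀ i x, ∀ v ∈ L i x, g x v v = a i x ^ 2 * ‖v‖ ^ 2 := by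
  have hne : ∀ {w : E3}, ‖w‖ = 1 → w ≠ 0 := fun h h0 => by simp [h0] at h
  choose u huL hu1 using fun i x => (hL i).exists_unit x
  have hli' : ∀ x (s : Fin 3 → E3), (∀ i, s i ∈ L i x) → (∀ i, ‖s i‖ = 1) →
      LinearIndependent ℝ s := fun x s hs hs1 => hli x s hs fun i => hne (hs1 i)
  set b : ∀ x, Module.Basis (Fin 3) ℝ E3 := fun x =>
    basisOfLinearIndependentOfCardEqFinrank (hli' x (fun i => u i x) (fun i => huL i x)
      fun i => hu1 i x) (by simp) with hb
  have hbu : ∀ x i, b x i = u i x := fun x i => by simp [hb]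
  -- The unit frame is chosen without continuity, but each coordinate enters twice, so its sign
  -- cancels.
  set g : T3 → E3 →ₗ[ℝ] E3 →ₗ[ℝ] ℝ := fun x =>
    ∑ i, (a i x ^ 2) • ((b x).coord i).smulRight ((b x).coord i) with hgdef
  have hg : ∀ x v w, g x v w = ∑ i, a i x ^ 2 * ((b x).repr v i * (b x).repr w i) := by
    intro x v w
    simp [hgdef, LinearMap.sum_apply]
  refine ⟨g, fun v w => ?_, fun x v w => ?_, ?_, fun i x v hv => ?_⟩
  · set K : Set (T3 × (Fin 3 → E3)) := {q | ∀ i, (q.1, q.2 i) ∈ totalSpace (L i) ∧ ‖q.2 i‖ = 1}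
      with hK
    have hKc : IsCompact K := by
      have h : K = (⋂ i, (fun q : T3 × (Fin 3 → E3) => ((q.1, q.2 i) : TT3)) ⁻¹'
          totalSpace (L i)) ∩ Set.univ ×ˢ Set.univ.pi fun _ => Metric.sphere (0 : E3) 1 := by
        ext q
        simp [hK, forall_and]
      rw [h]
      exact (isCompact_univ.prod (isCompact_univ_pi fun _ => isCompact_sphere 0 1)).inter_left
        (isClosed_iInter fun i => (hL i).isClosed.preimage (by fun_prop))
    set M : (Fin 3 → E3) → (Fin 3 → ℝ) →L[ℝ] E3 := fun s =>
      ∑ i, (ContinuousLinearMap.proj (R := ℝ) (φ := fun _ : Fin 3 => ℝ) i).smulRight (s i) with hM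
    have hMapply : ∀ s c, M s c = ∑ i, c i • s i := by
      intro s c
      simp [hM]
    have hMcont : Continuous M := by
      refine continuous_finsetSum _ fun i _ => ?_
      exact (ContinuousLinearMap.smulRightL ℝ (Fin 3 → ℝ) E3
        (ContinuousLinearMap.proj (R := ℝ) (φ := fun _ : Fin 3 => ℝ) i)).continuous.comp
        (continuous_apply i)
    have hMequiv : ∀ q ∈ K, ∃ e : (Fin 3 → ℝ) ≃L[ℝ] E3, (e : (Fin 3 → ℝ) →L[ℝ] E3) = M q.2 := by
      intro q hq
      have hs := hli' q.1 q.2 (fun i => (hq i).1) fun i => (hq i).2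
      refine ⟨(basisOfLinearIndependentOfCardEqFinrank hs
        (by simp)).equivFun.symm.toContinuousLinearEquiv, ?_⟩
      ext1 c
      rw [hMapply]
      simp [Module.Basis.equivFun_symm_apply]
    -- Any unit frame in the lines differs from the chosen one by signs; its coordinates, read from
    -- the inverse of `M`, depend continuously on the frame.
    have hcoord : ∀ q ∈ K, ∀ i, ∃ ε : ℝ, ε * ε = 1 ∧ ∀ v,
        ContinuousLinearMap.inverse (M q.2) v i = ε * (b q.1).repr v i := by
      intro q hq
      have hsgn : ∀ i, ∃ ε : ℝ, ε * ε = 1 ∧ u i q.1 = ε • q.2 i := by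
        intro i
        rcases eq_or_eq_neg_of_finrank_eq_one ((hL i).finrank_eq_one q.1) (hq i).1 (hq i).2
          (huL i q.1) (hu1 i q.1) with h | h
        · exact ⟨1, by norm_num, by simpa using h⟩
        · exact ⟨-1, by norm_num, by simpa using h⟩
      choose ε hε hεu using hsgn
      obtain ⟨e, he⟩ := hMequiv q hq
      refine fun i => ⟨ε i, hε i, fun v => ?_⟩
      have h1 : v = M q.2 fun i => ε i * (b q.1).repr v i := by
        rw [hMapply]
        conv_lhs => rw [← (b q.1).sum_repr v]
        refine Finset.sum_congr rfl fun i _ => ?_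
        rw [hbu, hεu, smul_smul, mul_comm]
      rw [← he] at h1 ⊢
      rw [ContinuousLinearMap.inverse_equiv]
      conv_lhs => rw [h1]
      simp
    have hinvc : ∀ v, ContinuousOn (fun q : T3 × (Fin 3 → E3) =>
        ContinuousLinearMap.inverse (M q.2) v) K := by
      intro v q hq
      obtain ⟨e, he⟩ := hMequiv q hq
      have h1 : ContinuousAt (ContinuousLinearMap.inverse (R := ℝ)) (M q.2) := by
        rw [← he]
        exact (contDiffAt_map_inverse (n := 0) e).continuousAt
      have h2 : ContinuousAt (fun q : T3 × (Fin 3 → E3) => M q.2) q :=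
        (hMcont.comp continuous_snd).continuousAt
      exact ((ContinuousAt.comp (f := fun q : T3 × (Fin 3 → E3) => M q.2) h1 h2).clm_apply
        continuousAt_const).continuousWithinAt
    refine continuous_of_comp_isCompact hKc continuous_fst
      (fun x => ⟨(x, fun i => u i x), fun i => ⟨huL i x, hu1 i x⟩, rfl⟩)
      (φ := fun q => ∑ i, a i q.1 ^ 2 * (ContinuousLinearMap.inverse (M q.2) v i *
        ContinuousLinearMap.inverse (M q.2) w i)) ?_ ?_
    · refine continuousOn_finsetSum _ fun i _ => ?_
      exact (((ha i).comp continuous_fst).pow 2).continuousOn.mul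
        (((continuous_apply i).comp_continuousOn (hinvc v)).mul
          ((continuous_apply i).comp_continuousOn (hinvc w)))
    · intro q hq
      rw [hg]
      refine Finset.sum_congr rfl fun i _ => ?_
      obtain ⟨ε, hε, h⟩ := hcoord q hq i
      rw [h v, h w]
      linear_combination (-(a i q.1 ^ 2 * (b q.1).repr v i * (b q.1).repr w i)) * hε
  · rw [hg, hg]
    exact Finset.sum_congr rfl fun i _ => by ring
  · choose m hm hmle using fun i => exists_pos_le_of_continuous (ha i) (ha0 i)
    obtain ⟨μ, hμ, hμle⟩ : ∃ μ : ℝ, 0 < μ ∧ ∀ i, μ ≤ m i :=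
      ⟨min (m 0) (min (m 1) (m 2)), lt_min (hm 0) (lt_min (hm 1) (hm 2)), fun i => by
        fin_cases i <;> simp⟩
    -- The 3 is the Cauchy–Schwarz constant for a sum of three coordinates.
    refine ⟨μ ^ 2 / 3, by positivity, fun x v => ?_⟩
    have h1 : ‖v‖ ≤ ∑ i, |(b x).repr v i| := by
      conv_lhs => rw [← (b x).sum_repr v]
      refine (norm_sum_le _ _).trans (Finset.sum_le_sum fun i _ => ?_)
      rw [norm_smul, hbu, hu1, mul_one, Real.norm_eq_abs]
    have h2 : ‖v‖ ^ 2 ≤ 3 * ∑ i, (b x).repr v i ^ 2 := by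
      have h3 := sq_sum_le_card_mul_sum_sq (s := Finset.univ) (f := fun i => |(b x).repr v i|)
      simp only [sq_abs, Finset.card_univ, Fintype.card_fin] at h3
      exact (pow_le_pow_left₀ (norm_nonneg v) h1 2).trans h3
    rw [hg]
    calc μ ^ 2 / 3 * ‖v‖ ^ 2 ≤ μ ^ 2 / 3 * (3 * ∑ i, (b x).repr v i ^ 2) := by gcongr
      _ = ∑ i, μ ^ 2 * (b x).repr v i ^ 2 := by rw [← Finset.mul_sum]; ring
      _ ≤ _ := Finset.sum_le_sum fun i _ => by
          rw [← sq]
          have := (hμle i).trans (hmle i x)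
          gcongr
  · obtain ⟨c, rfl⟩ := exists_eq_smul_of_finrank_eq_one ((hL i).finrank_eq_one x) (huL i x)
      (hne (hu1 i x)) hv
    rw [hg, norm_smul, hu1, ← hbu, Finset.sum_eq_single i]
    · simp [sq]
    · intro j _ hj
      simp [Finsupp.single_eq_of_ne hj]
    · simp

/-! ### The adapted metric and the conclusion. -/

/-- The uniform gap `κ` leaves room for the error made in smoothing the metric. -/
theorem exists_one_lt_forall_mul_le {φ ψ : T3 → ℝ} (hφ : Continuous φ) (hψ : Continuous ψ)
    (hφ0 : ∀ x, 0 < φ x) (h : ∀ x, φ x < ψ x) : ∃ κ, 1 < κ ∧ ∀ x, κ * φ x ≤ ψ x := by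
  obtain ⟨x, -, hx⟩ := isCompact_univ.exists_isMinOn Set.univ_nonempty
    (hψ.div hφ fun x => (hφ0 x).ne').continuousOn
  exact ⟨ψ x / φ x, (one_lt_div (hφ0 x)).2 (h x), fun y =>
    (le_div_iff₀ (hφ0 y)).1 (hx (Set.mem_univ y))⟩

theorem IsInvariantSplitting.linearIndependent {f : TorusDiffeo} {E₁ E₂ E₃ : T3 → Submodule ℝ E3}
    (h : IsInvariantSplitting f E₁ E₂ E₃) (x : T3) (s : Fin 3 → E3)
    (hs : ∀ i, s i ∈ (![E₁, E₂, E₃] i) x) (hs0 : ∀ i, s i ≠ 0) : LinearIndependent ℝ s := by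
  have h0 : s 0 ∈ E₁ x := hs 0
  have h1 : s 1 ∈ E₂ x := hs 1
  have h2 : s 2 ∈ E₃ x := hs 2
  have hs' : s = Fin.cons (s 0) ![s 1, s 2] := by
    ext i : 1
    fin_cases i <;> rfl
  rw [hs', linearIndependent_finCons]
  refine ⟨linearIndependent_pair_of_disjoint (h.disjoint x) h1 h2 (hs0 1) (hs0 2), fun hmem => ?_⟩
  refine hs0 0 (Submodule.disjoint_def.1 (h.isCompl x).disjoint _ h0 ?_)
  refine (Submodule.span_le.2 ?_) hmem
  rintro _ ⟨i, rfl⟩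
  fin_cases i
  · exact Submodule.mem_sup_left h1
  · exact Submodule.mem_sup_right h2

/-- An invariant splitting into lines whose growth rates over some fixed time are ordered is
partially hyperbolic for an adapted smooth metric. -/
theorem isPartiallyHyperbolic_of_orbitProd {f : TorusDiffeo} {E₁ E₂ E₃ : T3 → Submodule ℝ E3}
    (h : IsInvariantSplitting f E₁ E₂ E₃) {N : ℕ} (hN : N ≠ 0)
    (h₁₂ : ∀ x, orbitProd f (fun x => normOn (f.deriv x) (E₁ x)) N x <
      orbitProd f (fun x => normOn (f.deriv x) (E₂ x)) N x)
    (h₂₃ : ∀ x, orbitProd f (fun x => normOn (f.deriv x) (E₂ x)) N x <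
      orbitProd f (fun x => normOn (f.deriv x) (E₃ x)) N x)
    (h₁ : ∀ x, orbitProd f (fun x => normOn (f.deriv x) (E₁ x)) N x < 1)
    (h₃ : ∀ x, 1 < orbitProd f (fun x => normOn (f.deriv x) (E₃ x)) N x) :
    IsPartiallyHyperbolic f E₁ E₂ E₃ := by
  refine ⟨h, ?_⟩
  set L : Fin 3 → T3 → Submodule ℝ E3 := ![E₁, E₂, E₃] with hLdef
  have hL : ∀ i, IsInvariantLineField f (L i) := by
    intro i
    fin_cases i
    · exact h.bundle₁.isInvariantLineField h.invariant₁
    · exact h.bundle₂.isInvariantLineField h.invariant₂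
    · exact h.bundle₃.isInvariantLineField h.invariant₃
  choose a ha ha0 hcoh using fun i => exists_cohomologous_geom_mean (f := f)
    (hL i).continuous_normOn (hL i).normOn_pos hN
  -- The one-step rate on the line `L i` when its length is rescaled by `a i`; its `N`-th power is
  -- the growth over time `N`.
  set r : Fin 3 → T3 → ℝ := fun i x => normOn (f.deriv x) (L i x) * a i (f x) / a i x with hr
  have hr0 : ∀ i x, 0 < r i x := fun i x =>
    div_pos (mul_pos ((hL i).normOn_pos x) (ha0 i _)) (ha0 i x)
  have hrc : ∀ i, Continuous fun x => r i x ^ 2 := fun i =>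
    (((hL i).continuous_normOn.mul ((ha i).comp f.toHomeomorph.continuous)).div (ha i)
      fun x => (ha0 i x).ne').pow 2
  have hsq : ∀ {p q : ℝ}, 0 < p → 0 < q → p ^ N < q ^ N → p ^ 2 < q ^ 2 := fun hp hq hpq =>
    pow_lt_pow_left₀ (lt_of_pow_lt_pow_left₀ N hq.le hpq) hp.le two_ne_zero
  have hr01 : ∀ x, r 0 x ^ 2 < r 1 x ^ 2 := fun x => hsq (hr0 0 x) (hr0 1 x) (by
    rw [hcoh, hcoh]; exact h₁₂ x)
  have hr12 : ∀ x, r 1 x ^ 2 < r 2 x ^ 2 := fun x => hsq (hr0 1 x) (hr0 2 x) (by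
    rw [hcoh, hcoh]; exact h₂₃ x)
  have hr0' : ∀ x, r 0 x ^ 2 < 1 := fun x => by
    rw [← one_pow 2]; exact hsq (hr0 0 x) one_pos (by rw [hcoh, one_pow]; exact h₁ x)
  have hr2' : ∀ x, 1 < r 2 x ^ 2 := fun x => by
    rw [← one_pow 2]; exact hsq one_pos (hr0 2 x) (by rw [hcoh, one_pow]; exact h₃ x)
  obtain ⟨κ₁, hκ₁, hle₁⟩ := exists_one_lt_forall_mul_le (hrc 0) (hrc 1)
    (fun x => pow_pos (hr0 0 x) 2) hr01
  obtain ⟨κ₂, hκ₂, hle₂⟩ := exists_one_lt_forall_mul_le (hrc 1) (hrc 2)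
    (fun x => pow_pos (hr0 1 x) 2) hr12
  obtain ⟨κ₃, hκ₃, hle₃⟩ := exists_one_lt_forall_mul_le (hrc 0) continuous_const
    (fun x => pow_pos (hr0 0 x) 2) hr0'
  obtain ⟨κ₄, hκ₄, hle₄⟩ := exists_one_lt_forall_mul_le continuous_const (hrc 2)
    (fun x => one_pos) hr2'
  -- Smoothing alters a squared one-step rate by a factor at most `(1 + δ) / (1 - δ)`; comparing two
  -- lines costs this factor twice, hence the square.
  obtain ⟨δ, hδ0, hδ1, hδ⟩ : ∃ δ : ℝ, 0 < δ ∧ δ < 1 ∧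
      ((1 + δ) / (1 - δ)) ^ 2 < min (min κ₁ κ₂) (min κ₃ κ₄) := by
    have hc : ContinuousAt (fun δ : ℝ => ((1 + δ) / (1 - δ)) ^ 2) 0 :=
      ((continuousAt_const.add continuousAt_id).div (continuousAt_const.sub continuousAt_id)
        (by norm_num)).pow 2
    have h1 := hc.eventually_lt_const (u := min (min κ₁ κ₂) (min κ₃ κ₄)) (by
      simpa using ⟨⟨hκ₁, hκ₂⟩, hκ₃, hκ₄⟩)
    have h2 : ∀ᶠ δ : ℝ in 𝓝 0, δ < 1 := eventually_lt_nhds one_pos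
    obtain ⟨δ, ⟨h3, h4⟩, h5⟩ := (((h1.and h2).filter_mono nhdsWithin_le_nhds).and
      (self_mem_nhdsWithin (a := (0 : ℝ)) (s := Set.Ioi 0))).exists
    exact ⟨δ, h5, h4, h3⟩
  set η := (1 + δ) / (1 - δ) with hη
  have hη1 : 1 < η := (one_lt_div (by linarith)).2 (by linarith)
  have hη0 : 0 < η := one_pos.trans hη1
  have hηη : η < η ^ 2 := by nlinarith
  simp only [lt_min_iff] at hδ
  obtain ⟨g, hgc, hgs, ⟨m, hm, hgm⟩, hgL⟩ := exists_orthogonal_metric hL h.linearIndependent ha ha0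
  obtain ⟨G, hG⟩ := exists_torusRiemannianMetric_close g hgc hgs hm hgm hδ0 hδ1
  have hg0 : ∀ x v, 0 ≤ g x v v := fun x v => (by positivity : 0 ≤ m * ‖v‖ ^ 2).trans (hgm x v)
  have hgr : ∀ i x, ∀ v ∈ L i x, g (f x) (f.deriv x v) (f.deriv x v) = r i x ^ 2 * g x v v := by
    intro i x v hv
    rw [hgL i _ _ (((hL i).deriv_mem_iff x v).2 hv), hgL i x v hv, (hL i).norm_deriv hv]
    have := (ha0 i x).ne'
    simp only [hr]
    field_simp
  have hδ' : 0 < 1 - δ := by linarith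
  have hup : ∀ i x, ∀ v ∈ L i x,
      G.inner (f x) (f.deriv x v) (f.deriv x v) ≤ η * r i x ^ 2 * G.inner x v v := by
    intro i x v hv
    calc G.inner (f x) (f.deriv x v) (f.deriv x v) ≤ (1 + δ) * (r i x ^ 2 * g x v v) := by
          rw [← hgr i x v hv]; exact (hG _ _).2
      _ = η * r i x ^ 2 * ((1 - δ) * g x v v) := by rw [hη]; field_simp
      _ ≤ η * r i x ^ 2 * G.inner x v v := by
          have := (hG x v).1
          gcongr
  have hlow : ∀ i x, ∀ v ∈ L i x,
      r i x ^ 2 * G.inner x v v ≤ η * G.inner (f x) (f.deriv x v) (f.deriv x v) := by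
    intro i x v hv
    calc r i x ^ 2 * G.inner x v v ≤ r i x ^ 2 * ((1 + δ) * g x v v) := by
          have := (hG x v).2
          gcongr
      _ = η * ((1 - δ) * g (f x) (f.deriv x v) (f.deriv x v)) := by
          rw [hgr i x v hv, hη]; field_simp
      _ ≤ η * G.inner (f x) (f.deriv x v) (f.deriv x v) := by
          have := (hG (f x) (f.deriv x v)).1
          gcongr
  have hone : ∀ {x v}, G.norm x v = 1 → G.inner x v v = 1 := fun hv => Real.sqrt_eq_one.1 hv
  have hcompare : ∀ i j x, ∀ v ∈ L i x, ∀ w ∈ L j x, G.norm x v = 1 → G.norm x w = 1 →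
      η ^ 2 * r i x ^ 2 < r j x ^ 2 → G.norm (f x) (f.deriv x v) < G.norm (f x) (f.deriv x w) := by
    intro i j x v hv w hw hv1 hw1 hlt
    have h1 := hup i x v hv
    have h2 := hlow j x w hw
    rw [hone hv1, mul_one] at h1
    rw [hone hw1, mul_one] at h2
    have h3 : G.inner (f x) (f.deriv x v) (f.deriv x v) <
        G.inner (f x) (f.deriv x w) (f.deriv x w) := by
      refine lt_of_mul_lt_mul_left (a := η) ?_ hη0.le
      calc η * G.inner (f x) (f.deriv x v) (f.deriv x v) ≤ η * (η * r i x ^ 2) := by gcongr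
        _ = η ^ 2 * r i x ^ 2 := by ring
        _ < r j x ^ 2 := hlt
        _ ≤ _ := h2
    have hw0 : w ≠ 0 := fun h0 => by simp [h0, TorusRiemannianMetric.norm] at hw1
    exact (Real.sqrt_lt_sqrt_iff_of_pos (G.pos _ _ fun h0 =>
      hw0 ((f.deriv x).map_eq_zero_iff.1 h0))).2 h3
  refine ⟨G, fun x vs hvs vc hvc vu hvu hs1 hc1 hu1 => ⟨?_, ?_⟩, fun x vs hvs hs1 => ?_,
    fun x vu hvu hu1 => ?_⟩
  · refine hcompare 0 1 x vs hvs vc hvc hs1 hc1 (lt_of_lt_of_le ?_ (hle₁ x))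
    exact mul_lt_mul_of_pos_right hδ.1.1 (pow_pos (hr0 0 x) 2)
  · refine hcompare 1 2 x vc hvc vu hvu hc1 hu1 (lt_of_lt_of_le ?_ (hle₂ x))
    exact mul_lt_mul_of_pos_right hδ.1.2 (pow_pos (hr0 1 x) 2)
  · have h1 := hup 0 x vs hvs
    rw [hone hs1, mul_one] at h1
    rw [TorusRiemannianMetric.norm, Real.sqrt_lt' one_pos, one_pow]
    refine h1.trans_lt (lt_of_lt_of_le ?_ (hle₃ x))
    exact mul_lt_mul_of_pos_right (hηη.trans hδ.2.1) (pow_pos (hr0 0 x) 2)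
  · obtain ⟨⟨y, w⟩, hyw⟩ := f.tangentMap.surjective (x, vu)
    obtain ⟨rfl, rfl⟩ := Prod.mk.inj hyw
    have hw : w ∈ L 2 y := ((hL 2).deriv_mem_iff y w).1 hvu
    rw [← hyw, Equiv.symm_apply_apply]
    have h1 := hlow 2 y w hw
    have h2 : G.inner (f y) (f.deriv y w) (f.deriv y w) = 1 := hone hu1
    rw [h2, mul_one] at h1
    rw [TorusRiemannianMetric.norm, Real.sqrt_lt' one_pos, one_pow]
    have h3 := hle₄ y
    have h4 : η < r 2 y ^ 2 := by linarith [hδ.2.2]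
    refine lt_of_mul_lt_mul_left (a := r 2 y ^ 2) ?_ (sq_nonneg _)
    linarith

theorem mainTheorem7 (f : TorusDiffeo) (E G : T3 → Submodule ℝ E3)
    (hE : IsSubbundle 2 E) (hG : IsSubbundle 2 G)
    (hEinv : IsInvariantBundle f E) (hGinv : IsInvariantBundle f G)
    (hEG : ∀ x, E x ⊔ G x = ⊤)
    (CE CG : Set TT3) (hCE : IsClosedCone CE E) (hCG : IsClosedCone CG G)
    (hCEF : ConeTransverse CE fun x => E x ⊓ G x)
    (hCGF : ConeTransverse CG fun x => E x ⊓ G x)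
    (hCGint : f.tangentMap '' CG ⊆ coneInterior CG G)
    (hCEint : f.tangentMap.symm '' CE ⊆ coneInterior CE E) :
    ∃ E' G' : T3 → Submodule ℝ E3,
      totalSpace E' = ⋂ n : ℕ, f.tangentMap.symm^[n] '' CE ∧
      totalSpace G' = ⋂ n : ℕ, f.tangentMap^[n] '' CG ∧
      IsDominatedSplitting f E' (fun x => E x ⊓ G x) G' ∧
      ((∀ x : T3,
          absDetOn (f.deriv x) (E x) < normOn (f.deriv x) (E x ⊓ G x) ∧
          normOn (f.deriv x) (E x ⊓ G x) < absDetOn (f.deriv x) (G x)) →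
        IsPartiallyHyperbolic f E' (fun x => E x ⊓ G x) G') := by
  obtain ⟨E', G', hE', hG', hdom, hE'E, hG'G⟩ := isDominatedSplitting_of_cones f E G hE hG hEinv
    hGinv hEG CE CG hCE hCG hCEF hCGF hCGint hCEint
  refine ⟨E', G', hE', hG', hdom, fun hdet => ?_⟩
  have hs := hdom.splitting
  have h1 := hs.bundle₁.isInvariantLineField hs.invariant₁
  have h2 := hs.bundle₂.isInvariantLineField hs.invariant₂
  have h3 := hs.bundle₃.isInvariantLineField hs.invariant₃
  -- Each inequality holds at all large times, so one `N` serves for all; it must be nonzero for the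
  -- `N`-th roots.
  obtain ⟨N, ⟨⟨⟨h₁₂, h₂₃⟩, h₁⟩, h₃⟩, hN⟩ :=
    ((((hdom.dominated₁₂.eventually_orbitProd_lt h1 h2).and
      (hdom.dominated₂₃.eventually_orbitProd_lt h2 h3)).and
      (eventually_contracting h1 h2 (fun x => (hs.isCompl x).disjoint.mono_right le_sup_left)
        hE.finrank_eq hE'E (fun x => inf_le_left) fun x => (hdet x).1)).and
      (eventually_expanding h3 h2 (fun x => (hs.disjoint x).symm)
        hG.finrank_eq hG'G (fun x => inf_le_right) fun x => (hdet x).2)).and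
      (Filter.eventually_ne_atTop 0) |>.exists
  exact isPartiallyHyperbolic_of_orbitProd hs hN h₁₂ h₂₃ h₁ h₃
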